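/- **Theorem.** For a finite family $\mathcal F$ of finite sets and finite sets $B$, put $\mathcal F(B)=\{F\setminus B : F\in\mathcal F,\ B\subseteq F\}$; for a family $\mathcal B$ put $\mathcal F[\mathcal B]=\{F\in\mathcal F : B\subseteq F \text{ for some } B\in\mathcal B\}$. Let $\partial_h\mathcal F$ be the family of all $h$-element subsets of members of $\mathcal F$, and $\partial_{\le h}\mathcal F=\bigcup_{h'\le h}\partial_{h'}\mathcal F$. A family $\mathcal F$ is *$R$-spread* if $|\mathcal F(X)|\le R^{-|X|}|\mathcal F|$ for every finite set $X$, and a $k$-uniform family $\mathcal A$ (all members have size $k$) is *$(r,t)$-spread* if $\mathcal A(T)$ is $r$-spread for every $T\in\partial_{\le t}\mathcal A$. A *sunflower with $s$ petals* consists of $s$ distinct sets $F_1,\dots,F_s$ such that $F_i\cap F_j=\bigcap_{u=1}^s F_u$ for all $i\ne j$; the set $\bigcap_{u=1}^s F_u$ is its *core*. Let $s\ge 2$ and $k\ge t\ge 2$ be integers and let $r$ be a real number. Let $\mathcal A$ be a finite $k$-uniform $(r,t)$-spread family, where $$r\ge 2^{18}s(t+1)\log_2 r\qquad\text{and}\qquad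 r\ge 2^{15}s\log_2 k .$$ Suppose that $\mathcal F\subseteq\mathcal A$ contains no sunflower with $s$ petals and core of size at most $t-1$. Then there exists a family $\mathcal T\subseteq\partial_t\mathcal A$ that contains no sunflower with $s$ petals (and any core) such that $$|\mathcal F\setminus\mathcal F[\mathcal T]|\le (2^{14}s\log_2 t)^t\cdot\frac{2^{19}s(t+1)\log_2 r}{r}\cdot A_t,\qquad A_t=\max_{T\in\partial_t\mathcal A}|\mathcal A(T)|,$$ where $A_t=0$ if $\mathcal A=\varnothing$. -/

import Mathlib

namespace SpreadFamily

variable {α : Type*} [DecidableEq α]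

/-- `𝓕(A, B) = {F \ B ∣ F ∈ 𝓕, F ∩ B = A}`. -/
def restriction (𝓕 : Finset (Finset α)) (A B : Finset α) : Finset (Finset α) :=
  (𝓕.filter fun F => F ∩ B = A).image fun F => F \ B

/-- `𝓕(B) = 𝓕(B, B)`. -/
def link (𝓕 : Finset (Finset α)) (B : Finset α) : Finset (Finset α) :=
  restriction 𝓕 B B

/-- `𝓕[𝓑]`: the members of `𝓕` that contain some member of `𝓑`. -/
def above (𝓕 𝓑 : Finset (Finset α)) : Finset (Finset α) :=
  𝓕.filter fun F => ∃ B ∈ 𝓑, B ⊆ F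

/-- The shadow `∂_h 𝓕`: all `h`-element subsets of members of `𝓕`. -/
def layerShadow (h : ℕ) (𝓕 : Finset (Finset α)) : Finset (Finset α) :=
  𝓕.biUnion fun F => F.powersetCard h

/-- The shadow `∂_{≤ h} 𝓕`. -/
def lowerShadow (h : ℕ) (𝓕 : Finset (Finset α)) : Finset (Finset α) :=
  (Finset.range (h + 1)).biUnion fun h' => layerShadow h' 𝓕

/-- `𝓕` is `R`-spread: `|𝓕(X)| ≤ R^{-|X|} |𝓕|` for every finite set `X`. -/
def IsSpread (R : ℝ) (𝓕 : Finset (Finset α)) : Prop :=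
  ∀ X : Finset α, ((link 𝓕 X).card : ℝ) ≤ R ^ (-(X.card : ℤ)) * (𝓕.card : ℝ)

/-- `𝓐` is `(r, t)`-spread: `𝓐(T)` is `r`-spread for every `T ∈ ∂_{≤ t} 𝓐`. -/
def IsLocallySpread (r : ℝ) (t : ℕ) (𝓐 : Finset (Finset α)) : Prop :=
  ∀ T ∈ lowerShadow t 𝓐, IsSpread r (link 𝓐 T)

/-- The `s` pairwise distinct sets `F 0, …, F (s - 1)` form a sunflower with `s` petals
and core `C`: `C` is their common intersection, and any two of them meet exactly in `C`. -/
structure IsSunflower (s : ℕ) (F : Fin s → Finset α) (C : Finset α) : Prop where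
  distinct : Function.Injective F
  core_eq : (C : Set α) = ⋂ u, (F u : Set α)
  inter_eq : ∀ i j, i ≠ j → F i ∩ F j = C

/-- `𝓕` contains a sunflower with `s` petals (and arbitrary core). -/
def HasSunflower (s : ℕ) (𝓕 : Finset (Finset α)) : Prop :=
  ∃ (F : Fin s → Finset α) (C : Finset α), (∀ i, F i ∈ 𝓕) ∧ IsSunflower s F C

/-- `𝓕` contains a sunflower with `s` petals and core of size at most `m`. -/
def HasSunflowerCoreLE (s m : ℕ) (𝓕 : Finset (Finset α)) : Prop :=
  ∃ (F : Fin s → Finset α) (C : Finset α),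
    (∀ i, F i ∈ 𝓕) ∧ IsSunflower s F C ∧ C.card ≤ m

/-- `A_t = max_{T ∈ ∂_t 𝓐} |𝓐(T)|`. -/
def maxLink (t : ℕ) (𝓐 : Finset (Finset α)) : ℕ :=
  (layerShadow t 𝓐).sup fun T => (link 𝓐 T).card

end SpreadFamily

/-! The members of `𝓕` are shrunk in stages to `t`-sets, and every stage preserves the absence of
weak sunflowers: `s` indexed sets, repetitions allowed, whose pairwise intersections all equal one
set of size below `t`. Allowing repetitions matters because different members may shrink to the same
set. Absence passes down because intersection patterns lift: given `s` shrunken sets, one finds sets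
above them with the same pairwise intersections.

Shrinking is by spread approximation (`exists_spread_approximation`). A largest `B` with `|I| ≤
|I(B)| R^|B|` has an `R`-spread family above it; peel this family off and repeat until `|B|` exceeds
a threshold. Local spreadness bounds what is then left by `R^|B| r^(t-|B|) A_t`.

The first round uses `R = r/2` and leaves sets of size about `(t+1) log₂(r/s)`. Its lift
(`exists_lift_of_spread`) needs disjoint members of spread families, found by random colouring at a
cost logarithmic in `k`. The sets are now so small that a spreadness just above `s q₁` permits a
greedy lift (`exists_lift_of_degree_le`); a second round with this value leaves sets of size at most
`t² + t`, whose logarithm is `O(log t)`.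

Finally `𝓣` consists of the `t`-sets below many shrunken sets. Local spreadness makes every degree
above such a set small, so the greedy lift applies again. If no heavy `t`-set lies below the
shrunken sets of a subfamily, take its spread core `B`: if `|B| < t`, disjoint members above `B`
give a weak sunflower; if `|B| = t`, `B` is not heavy; if `|B| > t`, local spreadness applies.

The probabilistic engine is `biasedMean_miss_le`, a minimal-fragment argument: random sets are
exposed one at a time, and what remains to be covered halves in size unless the large fragments are
exceptionally costly. -/

namespace SpreadFamily

variable {α : Type*} [DecidableEq α]

/-! ### Random subsets and random colourings -/

/-- The expectation of `g W` when each element of `Ω` lies in `W` independently with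
probability `p`. -/
noncomputable def biasedMean (p : ℝ) (Ω : Finset α) (g : Finset α → ℝ) : ℝ :=
  ∑ W ∈ Ω.powerset, p ^ W.card * (1 - p) ^ (Ω \ W).card * g W

lemma biasedMean_empty (p : ℝ) (g : Finset α → ℝ) : biasedMean p ∅ g = g ∅ := by
  simp [biasedMean]

lemma biasedMean_insert (p : ℝ) {Ω : Finset α} {a : α} (ha : a ∉ Ω) (g : Finset α → ℝ) :
    biasedMean p (insert a Ω) g =
      (1 - p) * biasedMean p Ω g + p * biasedMean p Ω fun W => g (insert a W) := by
  unfold biasedMean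
  rw [Finset.sum_powerset_insert ha, Finset.mul_sum, Finset.mul_sum]
  congr 1
  · refine Finset.sum_congr rfl fun W hW => ?_
    have haW : a ∉ W := fun h => ha (Finset.mem_powerset.1 hW h)
    rw [Finset.insert_sdiff_of_notMem _ haW, Finset.card_insert_of_notMem (by simp [ha])]
    ring
  · refine Finset.sum_congr rfl fun W hW => ?_
    have haW : a ∉ W := fun h => ha (Finset.mem_powerset.1 hW h)
    rw [Finset.card_insert_of_notMem haW, Finset.insert_sdiff_insert,
      Finset.sdiff_insert_of_notMem ha]
    ring

lemma biasedMean_mono {p : ℝ} (h0 : 0 ≤ p) (h1 : p ≤ 1) {Ω : Finset α} {g h : Finset α → ℝ}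
    (hgh : ∀ W ⊆ Ω, g W ≤ h W) : biasedMean p Ω g ≤ biasedMean p Ω h := by
  refine Finset.sum_le_sum fun W hW => ?_
  have : 0 ≤ 1 - p := by linarith
  exact mul_le_mul_of_nonneg_left (hgh W (Finset.mem_powerset.1 hW)) (by positivity)

lemma biasedMean_add (p : ℝ) (Ω : Finset α) (g h : Finset α → ℝ) :
    biasedMean p Ω (fun W => g W + h W) = biasedMean p Ω g + biasedMean p Ω h := by
  simp [biasedMean, mul_add, Finset.sum_add_distrib]

lemma biasedMean_const_mul (p : ℝ) (Ω : Finset α) (c : ℝ) (g : Finset α → ℝ) :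
    biasedMean p Ω (fun W => c * g W) = c * biasedMean p Ω g := by
  unfold biasedMean
  rw [Finset.mul_sum]
  exact Finset.sum_congr rfl fun W _ => by ring

lemma biasedMean_const (p : ℝ) (Ω : Finset α) (c : ℝ) :
    biasedMean p Ω (fun _ => c) = c := by
  induction Ω using Finset.induction_on with
  | empty => exact biasedMean_empty _ _
  | insert a Ω ha ih => rw [biasedMean_insert p ha, ih]; ring

/-- An element is missed by two independent random sets with probability `(1 - p)(1 - q)`. This lets
a random set be exposed in rounds. -/
lemma biasedMean_union (p q : ℝ) (Ω : Finset α) (g : Finset α → ℝ) :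
    biasedMean p Ω (fun V => biasedMean q Ω fun W => g (V ∪ W)) =
      biasedMean (p + q - p * q) Ω g := by
  induction Ω using Finset.induction_on generalizing g with
  | empty => simp [biasedMean_empty]
  | insert a Ω ha ih =>
    rw [biasedMean_insert p ha, biasedMean_insert (p + q - p * q) ha, ← ih g,
      ← ih fun W => g (insert a W)]
    simp only [biasedMean_insert q ha, Finset.insert_union, Finset.union_insert,
      Finset.insert_idem, biasedMean_add, biasedMean_const_mul]
    ring

lemma biasedMean_antitone_prob {p q : ℝ} (h0 : 0 ≤ p) (hpq : p ≤ q) (h1 : q ≤ 1)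
    {Ω : Finset α} {g : Finset α → ℝ} (hg : Antitone g) :
    biasedMean q Ω g ≤ biasedMean p Ω g := by
  induction Ω using Finset.induction_on generalizing g with
  | empty => simp [biasedMean_empty]
  | insert a Ω ha ih =>
    rw [biasedMean_insert p ha, biasedMean_insert q ha]
    have e1 := ih hg
    have e2 := ih (g := fun W => g (insert a W))
      fun V W h => hg (Finset.insert_subset_insert a h)
    have e3 : biasedMean p Ω (fun W => g (insert a W)) ≤ biasedMean p Ω g :=
      biasedMean_mono h0 (hpq.trans h1) fun W _ => hg (Finset.subset_insert a W)
    nlinarith [mul_le_mul_of_nonneg_left e1 (sub_nonneg.2 h1),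
      mul_le_mul_of_nonneg_left e2 (h0.trans hpq), mul_nonneg (sub_nonneg.2 hpq) (sub_nonneg.2 e3)]

/-- Some colouring does at least as well as the uniformly random one. -/
lemma exists_colouring_le {m : ℕ} (hm : 0 < m) (Ω : Finset α) (g : Fin m → Finset α → ℝ) :
    ∃ f : α → Fin m,
      ∑ i, g i (Ω.filter fun x => f x = i) ≤ ∑ i, biasedMean (1 / m : ℝ) Ω (g i) := by
  have hm' : (m : ℝ) ≠ 0 := by positivity
  induction Ω using Finset.induction_on generalizing g with
  | empty => exact ⟨fun _ => ⟨0, hm⟩, by simp [biasedMean_empty]⟩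
  | insert a Ω ha ih =>
    -- Conditional expectations: `G c` is the objective once `a` has received colour `c`. Its mean
    -- over `c` is the full expectation, so some `c` does no worse.
    let G : Fin m → Fin m → Finset α → ℝ :=
      fun c i => if i = c then fun W => g i (insert a W) else g i
    have havg : ∑ c, ∑ i, biasedMean (1 / m : ℝ) Ω (G c i) =
        ∑ _c : Fin m, ∑ i, biasedMean (1 / m : ℝ) (insert a Ω) (g i) := by
      rw [Finset.sum_comm, Finset.sum_const, Finset.card_univ, Fintype.card_fin, nsmul_eq_mul,
        Finset.mul_sum]
      refine Finset.sum_congr rfl fun i _ => ?_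
      have : ∀ c, biasedMean (1 / m : ℝ) Ω (G c i) = biasedMean (1 / m : ℝ) Ω (g i) +
          if i = c then biasedMean (1 / m : ℝ) Ω (fun W => g i (insert a W)) -
            biasedMean (1 / m : ℝ) Ω (g i) else 0 := by
        intro c
        by_cases h : i = c <;> simp [G, h]
      simp only [this, Finset.sum_add_distrib, Finset.sum_ite_eq, Finset.mem_univ, if_true,
        Finset.sum_const, Finset.card_univ, Fintype.card_fin, nsmul_eq_mul]
      rw [biasedMean_insert _ ha]
      field_simp
      ring
    obtain ⟨c, -, hc⟩ := Finset.exists_le_of_sum_le ⟨⟨0, hm⟩, Finset.mem_univ _⟩ havg.le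
    obtain ⟨f, hf⟩ := ih (G c)
    refine ⟨Function.update f a c, le_trans (le_of_eq ?_) (hf.trans hc)⟩
    refine Finset.sum_congr rfl fun i _ => ?_
    have hΩ : (Ω.filter fun x => Function.update f a c x = i) = Ω.filter fun x => f x = i := by
      refine Finset.filter_congr fun x hx => ?_
      rw [Function.update_of_ne (fun h : x = a => ha (h ▸ hx))]
    rw [Finset.filter_insert, hΩ, Function.update_self]
    by_cases h : i = c
    · simp [G, h]
    · simp [G, h, Ne.symm h]

/-! ### Covers, minimal fragments and random sets -/

/-- Every family `U` such that each member of `H` contains a member of `U` has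
`∑ T ∈ U, R ^ (-|T|) ≥ κ`. -/
def CoverCostGE (R κ : ℝ) (H : Finset (Finset α)) : Prop :=
  ∀ U : Finset (Finset α), (∀ S ∈ H, ∃ T ∈ U, T ⊆ S) → κ ≤ ∑ T ∈ U, R⁻¹ ^ T.card

/-- The indicator of the event that `W` contains no member of `H`. -/
def miss (H : Finset (Finset α)) (W : Finset α) : ℝ :=
  if ∃ S ∈ H, S ⊆ W then 0 else 1

/-- The inclusion-minimal sets among the `S \ V` with `S ∈ H`. -/
def fragments (H : Finset (Finset α)) (V : Finset α) : Finset (Finset α) :=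
  (H.image fun S => S \ V).filter fun T => ∀ T' ∈ H.image fun S => S \ V, T' ⊆ T → T' = T

lemma miss_nonneg (H : Finset (Finset α)) (W : Finset α) : 0 ≤ miss H W := by
  unfold miss; split_ifs <;> norm_num

lemma miss_le_one (H : Finset (Finset α)) (W : Finset α) : miss H W ≤ 1 := by
  unfold miss; split_ifs <;> norm_num

lemma miss_le_miss {H H' : Finset (Finset α)} {W W' : Finset α}
    (h : (∃ S ∈ H', S ⊆ W') → ∃ S ∈ H, S ⊆ W) : miss H W ≤ miss H' W' := by
  unfold miss
  split_ifs with h1 h2 h2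
  · exact le_rfl
  · norm_num
  · exact absurd (h h2) h1
  · exact le_rfl

lemma miss_antitone (H : Finset (Finset α)) : Antitone (miss H) := fun _ _ hVW =>
  miss_le_miss fun ⟨S, hS, hSV⟩ => ⟨S, hS, hSV.trans hVW⟩

lemma exists_fragment_subset {H : Finset (Finset α)} {S : Finset α} (hS : S ∈ H)
    (V : Finset α) : ∃ T ∈ fragments H V, T ⊆ S \ V := by
  obtain ⟨T, hT, hmin⟩ := Finset.exists_min_image
    ((H.image fun S => S \ V).filter fun T => T ⊆ S \ V) Finset.card
    ⟨S \ V, Finset.mem_filter.2 ⟨Finset.mem_image_of_mem _ hS, subset_rfl⟩⟩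
  rw [Finset.mem_filter] at hT
  refine ⟨T, Finset.mem_filter.2 ⟨hT.1, fun T' hT' hsub => ?_⟩, hT.2⟩
  exact Finset.eq_of_subset_of_card_le hsub
    (hmin T' (Finset.mem_filter.2 ⟨hT', hsub.trans hT.2⟩))

lemma exists_of_mem_fragments {H : Finset (Finset α)} {V T : Finset α}
    (hT : T ∈ fragments H V) : ∃ S ∈ H, S \ V = T :=
  Finset.mem_image.1 (Finset.mem_filter.1 hT).1

/-- If `T` is a fragment for `V = Z \ T`, it lies in every member of `H` inside `Z`. -/
lemma fragment_subset {H : Finset (Finset α)} {Z T S : Finset α}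
    (hT : T ∈ fragments H (Z \ T)) (hS : S ∈ H) (hSZ : S ⊆ Z) : T ⊆ S := by
  have h := (Finset.mem_filter.1 hT).2 _ (Finset.mem_image_of_mem _ hS) fun x hx => by
    simp only [Finset.mem_sdiff, not_and, not_not] at hx
    exact hx.2 (hSZ hx.1)
  rw [← h]
  exact Finset.sdiff_subset

/-- Double counting over `Z = V ∪ T`. Passing from `V` to `Z` gains `p ^ |T|`, which pays for `R⁻¹ ^
|T|` with `64 ^ (-|T|)` to spare, while one member of `H` inside `Z` contains all fragments `T` that
arise from `Z`. -/
lemma biasedMean_large_fragments_le {R p : ℝ} (hp0 : 0 < p) (hp1 : p ≤ 1) (hpR : 64 ≤ p * R)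
    {Ω : Finset α} {L : ℕ} {H : Finset (Finset α)}
    (hH : ∀ S ∈ H, S ⊆ Ω ∧ S.card < 2 ^ (L + 1)) :
    biasedMean p Ω (fun V => ∑ T ∈ (fragments H V).filter fun T => 2 ^ L ≤ T.card,
      R⁻¹ ^ T.card) ≤ (1 / 16) ^ 2 ^ L := by
  have hq : 0 ≤ 1 - p := by linarith
  have hR : 0 < R := by by_contra h; nlinarith
  have hRp : R⁻¹ ≤ p * (1 / 64) := by
    rw [inv_le_iff_one_le_mul₀ hR]; linarith
  set w : Finset α → ℝ := fun V => p ^ V.card * (1 - p) ^ (Ω \ V).card with hw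
  have hw0 : ∀ V, 0 ≤ w V := fun V => by positivity
  set P := Ω.powerset
  let valid : Finset α → Finset α → Prop := fun V T => T ∈ fragments H V ∧ 2 ^ L ≤ T.card
  have hPsub : ∀ V T, valid V T → T ∈ P := by
    intro V T h
    obtain ⟨S, hS, rfl⟩ := exists_of_mem_fragments h.1
    exact Finset.mem_powerset.2 (Finset.sdiff_subset.trans (hH S hS).1)
  have hdisj : ∀ V T, valid V T → Disjoint V T := by
    intro V T h
    obtain ⟨S, hS, rfl⟩ := exists_of_mem_fragments h.1
    exact Finset.disjoint_sdiff
  calc biasedMean p Ω (fun V => ∑ T ∈ (fragments H V).filter fun T => 2 ^ L ≤ T.card,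
        R⁻¹ ^ T.card)
      = ∑ V ∈ P, ∑ T ∈ (fragments H V).filter fun T => 2 ^ L ≤ T.card,
          w V * R⁻¹ ^ T.card := by
        simp only [biasedMean, Finset.mul_sum, hw, P]
    _ = ∑ T ∈ P, ∑ V ∈ P.filter fun V => valid V T, w V * R⁻¹ ^ T.card := by
        refine Finset.sum_comm' fun V T => ?_
        simp only [Finset.mem_filter]
        exact ⟨fun h => ⟨⟨h.1, h.2⟩, hPsub V T h.2⟩, fun h => h.1⟩
    _ ≤ ∑ T ∈ P, ∑ Z ∈ P.filter fun Z => T ⊆ Z ∧ valid (Z \ T) T, w Z * (1 / 64) ^ T.card := by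
        refine Finset.sum_le_sum fun T hT => ?_
        have hinj : Set.InjOn (fun V => V ∪ T) (P.filter fun V => valid V T) := by
          intro V hV V' hV' h
          have h1 := hdisj V T (Finset.mem_filter.1 hV).2
          have h2 := hdisj V' T (Finset.mem_filter.1 hV').2
          have : (V ∪ T) \ T = (V' ∪ T) \ T := by rw [show V ∪ T = V' ∪ T from h]
          rwa [Finset.union_sdiff_cancel_right h1, Finset.union_sdiff_cancel_right h2] at this
        calc ∑ V ∈ P.filter fun V => valid V T, w V * R⁻¹ ^ T.card
            ≤ ∑ V ∈ P.filter fun V => valid V T, w (V ∪ T) * (1 / 64) ^ T.card := by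
              refine Finset.sum_le_sum fun V hV => ?_
              have h1 := hdisj V T (Finset.mem_filter.1 hV).2
              simp only [hw]
              rw [Finset.card_union_of_disjoint h1, pow_add]
              calc p ^ V.card * (1 - p) ^ (Ω \ V).card * R⁻¹ ^ T.card
                  ≤ p ^ V.card * (1 - p) ^ (Ω \ (V ∪ T)).card * (p * (1 / 64)) ^ T.card := by
                    have e1 : (1 - p) ^ (Ω \ V).card ≤ (1 - p) ^ (Ω \ (V ∪ T)).card :=
                      pow_le_pow_of_le_one hq (by linarith)
                        (Finset.card_le_card
                          (Finset.sdiff_subset_sdiff subset_rfl Finset.subset_union_left))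
                    have e2 : R⁻¹ ^ T.card ≤ (p * (1 / 64)) ^ T.card :=
                      pow_le_pow_left₀ (by positivity) hRp _
                    gcongr
                _ = _ := by rw [mul_pow]; ring
          _ = ∑ Z ∈ (P.filter fun V => valid V T).image fun V => V ∪ T,
                w Z * (1 / 64) ^ T.card := 
              (Finset.sum_image (f := fun Z => w Z * (1 / 64) ^ T.card) hinj).symm
          _ ≤ _ := by
              refine Finset.sum_le_sum_of_subset_of_nonneg ?_ fun Z _ _ =>
                mul_nonneg (hw0 Z) (by positivity)
              intro Z hZ
              obtain ⟨V, hV, rfl⟩ := Finset.mem_image.1 hZ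
              rw [Finset.mem_filter] at hV ⊢
              rw [Finset.union_sdiff_cancel_right (hdisj V T hV.2)]
              exact ⟨Finset.mem_powerset.2 (Finset.union_subset (Finset.mem_powerset.1 hV.1)
                (Finset.mem_powerset.1 hT)), Finset.subset_union_right, hV.2⟩
    _ = ∑ Z ∈ P, ∑ T ∈ P.filter fun T => T ⊆ Z ∧ valid (Z \ T) T, w Z * (1 / 64) ^ T.card := by
        refine Finset.sum_comm' fun T Z => ?_
        simp only [Finset.mem_filter]
        tauto
    _ ≤ ∑ Z ∈ P, w Z * (1 / 16) ^ 2 ^ L := by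
        refine Finset.sum_le_sum fun Z hZ => ?_
        rw [← Finset.mul_sum]
        refine mul_le_mul_of_nonneg_left ?_ (hw0 Z)
        rcases (P.filter fun T => T ⊆ Z ∧ valid (Z \ T) T).eq_empty_or_nonempty with he | ⟨T₀, h₀⟩
        · rw [he, Finset.sum_empty]; positivity
        obtain ⟨-, hTZ, hv⟩ := Finset.mem_filter.1 h₀
        obtain ⟨S, hS, hST⟩ := exists_of_mem_fragments hv.1
        -- Any single fragment `T₀` yields a member `S` inside `Z`; by minimality every other
        -- fragment for this `Z` is then a subset of `S`.
        have hSZ : S ⊆ Z := by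
          intro x hx
          by_cases hxT : x ∈ T₀
          · exact hTZ hxT
          · by_contra hxZ
            exact hxT (hST ▸ Finset.mem_sdiff.2
              ⟨hx, fun h => hxZ (Finset.mem_sdiff.1 h).1⟩)
        have hsub : (P.filter fun T => T ⊆ Z ∧ valid (Z \ T) T) ⊆ S.powerset := fun T hT =>
          Finset.mem_powerset.2 (fragment_subset (Finset.mem_filter.1 hT).2.2.1 hS hSZ)
        have hcard : ((P.filter fun T => T ⊆ Z ∧ valid (Z \ T) T).card : ℝ) ≤ 2 ^ 2 ^ (L + 1) := by
          have h1 := Finset.card_le_card hsub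
          rw [Finset.card_powerset] at h1
          exact_mod_cast h1.trans (Nat.pow_le_pow_right two_pos (hH S hS).2.le)
        calc ∑ T ∈ P.filter fun T => T ⊆ Z ∧ valid (Z \ T) T, (1 / 64 : ℝ) ^ T.card
            ≤ ∑ T ∈ P.filter fun T => T ⊆ Z ∧ valid (Z \ T) T, (1 / 64 : ℝ) ^ 2 ^ L :=
              Finset.sum_le_sum fun T hT => pow_le_pow_of_le_one (by norm_num) (by norm_num)
                (Finset.mem_filter.1 hT).2.2.2
          _ ≤ 2 ^ 2 ^ (L + 1) * (1 / 64) ^ 2 ^ L := by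
              rw [Finset.sum_const, nsmul_eq_mul]
              gcongr
          -- The number of subsets is at most `2 ^ 2 ^ (L + 1) = 4 ^ 2 ^ L`, and `4 / 64 = 1 / 16`.
          _ = (1 / 16) ^ 2 ^ L := by
              rw [pow_succ 2 L, mul_comm (2 ^ L) 2, pow_mul, ← mul_pow]
              norm_num
    _ = (1 / 16) ^ 2 ^ L := by
        have := biasedMean_const p Ω ((1 / 16 : ℝ) ^ 2 ^ L)
        simpa only [biasedMean] using this

/-- A random set, the union of `M` independent `p`-random sets, contains a member of `H`
with high probability. -/
lemma biasedMean_miss_le {R p : ℝ} (hp0 : 0 < p) (hp1 : p ≤ 1) (hpR : 64 ≤ p * R)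
    {Ω : Finset α} (M : ℕ) : ∀ (L : ℕ) (H : Finset (Finset α)),
    (∀ S ∈ H, S ⊆ Ω ∧ S.card < 2 ^ L) → CoverCostGE R (1 - (1 / 2) ^ (L + 1)) H →
    biasedMean (1 - (1 - p) ^ M) Ω (miss H) ≤ 2 ^ L * (5 / 8) ^ M := by
  have hR : 0 < R := by by_contra h; nlinarith
  induction M with
  | zero =>
    intro L H hH hcost
    calc biasedMean (1 - (1 - p) ^ 0) Ω (miss H)
        ≤ biasedMean (1 - (1 - p) ^ 0) Ω fun _ => 1 :=
          biasedMean_mono (by simp) (by simp) fun W _ => miss_le_one H W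
      _ = 1 := biasedMean_const _ _ _
      _ ≤ 2 ^ L * (5 / 8) ^ 0 := by
          rw [pow_zero, mul_one]; exact one_le_pow₀ (by norm_num)
  | succ M ih =>
    intro L H hH hcost
    have hq0 : 0 ≤ 1 - (1 - p) ^ M := sub_nonneg.2 (pow_le_one₀ (by linarith) (by linarith))
    have hq1 : 1 - (1 - p) ^ M ≤ 1 := by
      have : 0 ≤ (1 - p) ^ M := pow_nonneg (by linarith) _
      linarith
    have hsplit : 1 - (1 - p) ^ (M + 1) =
        p + (1 - (1 - p) ^ M) - p * (1 - (1 - p) ^ M) := by ring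
    rw [hsplit, ← biasedMean_union]
    cases L with
    | zero =>
      -- Members have size below `2 ^ 0`, and cost at least `1/2` excludes the empty family, which
      -- the empty cover would serve at cost `0`.
      have hne : ∃ S ∈ H, S = ∅ := by
        by_contra hcon
        have hem : H = ∅ := by
          refine Finset.eq_empty_of_forall_notMem fun S hS => hcon ⟨S, hS, ?_⟩
          have := (hH S hS).2
          rw [pow_zero, Nat.lt_one_iff] at this
          exact Finset.card_eq_zero.1 this
        have := hcost ∅ (by simp [hem])
        norm_num at this
      obtain ⟨S, hS, rfl⟩ := hne
      have hz : ∀ W, miss H W = 0 := fun W => if_pos ⟨∅, hS, Finset.empty_subset _⟩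
      simp only [hz, biasedMean_const]
      positivity
    | succ L =>
      set big : Finset α → ℝ := fun V =>
        ∑ T ∈ (fragments H V).filter fun T => 2 ^ L ≤ T.card, R⁻¹ ^ T.card with hbig
      have hbig0 : ∀ V, 0 ≤ big V := fun V => Finset.sum_nonneg fun T _ => by positivity
      set η : ℝ := (1 / 2) ^ (L + 2) with hη
      have hη0 : 0 < η := by positivity
      have hmean : biasedMean p Ω big ≤ η / 4 := by
        refine (biasedMean_large_fragments_le hp0 hp1 hpR hH).trans ?_
        calc (1 / 16 : ℝ) ^ 2 ^ L ≤ (1 / 16) ^ (L + 1) :=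
              pow_le_pow_of_le_one (by norm_num) (by norm_num) Nat.lt_two_pow_self
          _ = (1 / 8) ^ (L + 1) * (1 / 2) ^ (L + 1) := by rw [← mul_pow]; norm_num
          _ ≤ (1 / 8) * (1 / 2) ^ (L + 1) := by
              refine mul_le_mul_of_nonneg_right ?_ (by positivity)
              exact pow_le_of_le_one (by norm_num) (by norm_num) (by omega)
          _ = η / 4 := by rw [hη]; ring
      -- Markov's inequality in linear form. If `big V ≤ η`, induction applies to the small
      -- fragments with `L`. Otherwise `big V / η > 1` pays for the bound with `L + 1`, which is
      -- twice as large.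
      have hpoint : ∀ V ⊆ Ω,
          biasedMean (1 - (1 - p) ^ M) Ω (fun W => miss H (V ∪ W)) ≤
            2 ^ L * (5 / 8) ^ M + (2 ^ L * (5 / 8) ^ M / η) * big V := by
        intro V hV
        by_cases hb : big V ≤ η
        · have h1 : biasedMean (1 - (1 - p) ^ M) Ω (fun W => miss H (V ∪ W)) ≤
              biasedMean (1 - (1 - p) ^ M) Ω
                (miss ((fragments H V).filter fun T => ¬ 2 ^ L ≤ T.card)) := by
            refine biasedMean_mono hq0 hq1 fun W _ => miss_le_miss ?_
            rintro ⟨T, hT, hTW⟩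
            obtain ⟨S, hS, rfl⟩ := exists_of_mem_fragments (Finset.mem_filter.1 hT).1
            refine ⟨S, hS, fun x hx => ?_⟩
            by_cases hxV : x ∈ V
            · exact Finset.mem_union_left _ hxV
            · exact Finset.mem_union_right _ (hTW (Finset.mem_sdiff.2 ⟨hx, hxV⟩))
          have h2 := ih L ((fragments H V).filter fun T => ¬ 2 ^ L ≤ T.card) ?_ ?_
          · have h3 : 0 ≤ (2 ^ L * (5 / 8) ^ M / η) * big V :=
              mul_nonneg (by positivity) (hbig0 V)
            linarith
          · intro T hT
            rw [Finset.mem_filter] at hT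
            obtain ⟨S, hS, rfl⟩ := exists_of_mem_fragments hT.1
            exact ⟨Finset.sdiff_subset.trans (hH S hS).1, not_le.1 hT.2⟩
          · intro U hU
            -- A cover of the small fragments together with all large fragments covers `H`, so the
            -- cost drops from `1 - η` to no less than `1 - 2η`, exactly the hypothesis for `L`.
            have h4 := hcost (U ∪ (fragments H V).filter fun T => 2 ^ L ≤ T.card) ?_
            · have h5 : ∑ T ∈ U ∪ (fragments H V).filter fun T => 2 ^ L ≤ T.card,
                  R⁻¹ ^ T.card ≤ ∑ T ∈ U, R⁻¹ ^ T.card + big V := by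
                rw [hbig, ← Finset.sum_union_inter]
                exact le_add_of_nonneg_right (Finset.sum_nonneg fun T _ => by positivity)
              have h6 : (1 / 2 : ℝ) ^ (L + 1) = 2 * η := by rw [hη]; ring
              rw [h6]
              linarith
            · intro S hS
              obtain ⟨T, hT, hTS⟩ := exists_fragment_subset hS V
              by_cases hl : 2 ^ L ≤ T.card
              · exact ⟨T, Finset.mem_union_right _ (Finset.mem_filter.2 ⟨hT, hl⟩),
                  hTS.trans Finset.sdiff_subset⟩
              · obtain ⟨T', hT', hs⟩ := hU T (Finset.mem_filter.2 ⟨hT, hl⟩)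
                exact ⟨T', Finset.mem_union_left _ hT',
                  hs.trans (hTS.trans Finset.sdiff_subset)⟩
        · have h1 : biasedMean (1 - (1 - p) ^ M) Ω (fun W => miss H (V ∪ W)) ≤
              biasedMean (1 - (1 - p) ^ M) Ω (miss H) :=
            biasedMean_mono hq0 hq1 fun W _ => miss_antitone H Finset.subset_union_right
          have h2 := ih (L + 1) H hH hcost
          have h3 : 2 ^ L * (5 / 8) ^ M ≤ (2 ^ L * (5 / 8) ^ M / η) * big V := by
            rw [div_mul_eq_mul_div, le_div_iff₀ hη0]
            exact mul_le_mul_of_nonneg_left (not_le.1 hb).le (by positivity)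
          have h4 : (2 : ℝ) ^ (L + 1) * (5 / 8) ^ M = 2 ^ L * (5 / 8) ^ M + 2 ^ L * (5 / 8) ^ M := by
            ring
          linarith
      calc biasedMean p Ω (fun V => biasedMean (1 - (1 - p) ^ M) Ω fun W => miss H (V ∪ W))
          ≤ biasedMean p Ω fun V =>
              2 ^ L * (5 / 8) ^ M + (2 ^ L * (5 / 8) ^ M / η) * big V :=
            biasedMean_mono hp0.le hp1 hpoint
        _ = 2 ^ L * (5 / 8) ^ M + (2 ^ L * (5 / 8) ^ M / η) * biasedMean p Ω big := by
            rw [biasedMean_add, biasedMean_const, biasedMean_const_mul]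
        _ ≤ 2 ^ L * (5 / 8) ^ M + (2 ^ L * (5 / 8) ^ M / η) * (η / 4) := by
            gcongr
        -- The factor is `1 + 1/4 = 2 · (5/8)`, which is where `5/8` comes from.
        _ = 2 ^ (L + 1) * (5 / 8) ^ (M + 1) := by
            field_simp
            ring

/-! ### Disjoint members of spread families -/

/-- The counting form of spreadness for an indexed family `τ i`, `i ∈ I`. -/
def IndexSpread {ι : Type*} (R : ℝ) (I : Finset ι) (τ : ι → Finset α) : Prop :=
  ∀ X : Finset α, ((I.filter fun i => X ⊆ τ i).card : ℝ) * R ^ X.card ≤ I.card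

/-- Union bound: each `T` in a cover accounts for at most a fraction `R ^ (-|T|)` of the indices. -/
lemma IndexSpread.coverCostGE {ι : Type*} {R : ℝ} (hR : 0 < R) {I : Finset ι}
    (hI : I.Nonempty) {τ : ι → Finset α} (h : IndexSpread R I τ) :
    CoverCostGE R 1 (I.image τ) := by
  classical
  intro U hU
  have hcard : (0 : ℝ) < I.card := by exact_mod_cast hI.card_pos
  have h1 : (I.card : ℝ) ≤ ∑ T ∈ U, ((I.filter fun i => T ⊆ τ i).card : ℝ) := by
    have : I ⊆ U.biUnion fun T => I.filter fun i => T ⊆ τ i := by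
      intro i hi
      obtain ⟨T, hT, hs⟩ := hU (τ i) (Finset.mem_image_of_mem _ hi)
      exact Finset.mem_biUnion.2 ⟨T, hT, Finset.mem_filter.2 ⟨hi, hs⟩⟩
    exact_mod_cast (Finset.card_le_card this).trans Finset.card_biUnion_le
  have h2 : ∑ T ∈ U, ((I.filter fun i => T ⊆ τ i).card : ℝ) ≤
      ∑ T ∈ U, I.card * R⁻¹ ^ T.card := by
    refine Finset.sum_le_sum fun T _ => ?_
    rw [inv_pow, ← div_eq_mul_inv, le_div_iff₀ (by positivity)]
    exact h T
  rw [← Finset.mul_sum] at h2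
  have h3 := h1.trans h2
  by_contra hlt
  push Not at hlt
  nlinarith

/-- `M` rounds of density `1 / (m M)` have a union of density at most `1 / m`, by Bernoulli's
inequality. So the bound applies to a colour class of a random `m`-colouring. -/
lemma IndexSpread.biasedMean_miss_le {ι : Type*} {R : ℝ} {m M L : ℕ} (hm : 0 < m)
    (hM : 0 < M) (hR : 64 * m * M ≤ R) {I : Finset ι} (hI : I.Nonempty) {τ : ι → Finset α}
    (h : IndexSpread R I τ) {Ω : Finset α} (hτ : ∀ i ∈ I, τ i ⊆ Ω ∧ (τ i).card < 2 ^ L) :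
    biasedMean (1 / m : ℝ) Ω (miss (I.image τ)) ≤ 2 ^ L * (5 / 8) ^ M := by
  have hm' : (1 : ℝ) ≤ m := by exact_mod_cast hm
  have hM' : (1 : ℝ) ≤ M := by exact_mod_cast hM
  set p : ℝ := 1 / (m * M) with hp
  have hp0 : 0 < p := by positivity
  have hp1 : p ≤ 1 := by
    rw [hp, div_le_one (by positivity)]; nlinarith
  have hR0 : 0 < R := lt_of_lt_of_le (by positivity) hR
  have hpR : 64 ≤ p * R := by
    rw [hp, one_div_mul_eq_div, le_div_iff₀ (by positivity)]; linarith
  have hle : 1 - (1 - p) ^ M ≤ 1 / m := by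
    have h1 := one_add_mul_le_pow (a := -p) (by linarith) M
    have h2 : (M : ℝ) * p = 1 / m := by rw [hp]; field_simp
    rw [← sub_eq_add_neg] at h1
    linarith
  have hq0 : 0 ≤ 1 - (1 - p) ^ M := sub_nonneg.2 (pow_le_one₀ (by linarith) (by linarith))
  refine (biasedMean_antitone_prob hq0 hle ?_ (miss_antitone _)).trans
    (SpreadFamily.biasedMean_miss_le hp0 hp1 hpR M L _ ?_ fun U hU => ?_)
  · rw [div_le_one (by positivity)]; exact hm'
  · intro S hS
    obtain ⟨i, hi, rfl⟩ := Finset.mem_image.1 hS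
    exact hτ i hi
  · have := h.coverCostGE hR0 hI U hU
    have : (0 : ℝ) < (1 / 2) ^ (L + 1) := by positivity
    linarith

/-- Several spread families have pairwise disjoint representatives. -/
lemma exists_pairwise_disjoint_of_spread {ι : Type*} {R : ℝ} {s M L : ℕ} (hs : 0 < s)
    (hM : 0 < M) (hR : 64 * s * M ≤ R) (hML : (s : ℝ) * (2 ^ L * (5 / 8) ^ M) < 1)
    {I : Fin s → Finset ι} (hI : ∀ j, (I j).Nonempty) {τ : Fin s → ι → Finset α}
    (h : ∀ j, IndexSpread R (I j) (τ j)) (hτ : ∀ j, ∀ i ∈ I j, (τ j i).card < 2 ^ L) :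
    ∃ c : Fin s → ι, (∀ j, c j ∈ I j) ∧
      ∀ j j', j ≠ j' → Disjoint (τ j (c j)) (τ j' (c j')) := by
  classical
  set Ω : Finset α := Finset.univ.biUnion fun j => (I j).biUnion (τ j) with hΩ
  have hsub : ∀ j, ∀ i ∈ I j, τ j i ⊆ Ω := fun j i hi x hx =>
    Finset.mem_biUnion.2 ⟨j, Finset.mem_univ _, Finset.mem_biUnion.2 ⟨i, hi, hx⟩⟩
  obtain ⟨f, hf⟩ := exists_colouring_le hs Ω fun j => miss ((I j).image (τ j))
  have hlt : ∑ j, miss ((I j).image (τ j)) (Ω.filter fun x => f x = j) < 1 := by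
    refine hf.trans_lt (lt_of_le_of_lt (Finset.sum_le_sum fun j _ =>
      (h j).biasedMean_miss_le hs hM hR (hI j) fun i hi => ⟨hsub j i hi, hτ j i hi⟩) ?_)
    simpa using hML
  have hex : ∀ j, ∃ i ∈ I j, τ j i ⊆ Ω.filter fun x => f x = j := by
    intro j
    by_contra hcon
    have h1 : miss ((I j).image (τ j)) (Ω.filter fun x => f x = j) = 1 := by
      refine if_neg ?_
      rintro ⟨S, hS, hsub⟩
      obtain ⟨i, hi, rfl⟩ := Finset.mem_image.1 hS
      exact hcon ⟨i, hi, hsub⟩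
    have h2 := Finset.single_le_sum (fun j _ => miss_nonneg ((I j).image (τ j))
      (Ω.filter fun x => f x = j)) (Finset.mem_univ j)
    linarith
  choose c hc hcs using hex
  refine ⟨c, hc, fun j j' hjj => Finset.disjoint_left.2 fun x hx hx' => hjj ?_⟩
  rw [← (Finset.mem_filter.1 (hcs j hx)).2, (Finset.mem_filter.1 (hcs j' hx')).2]

/-- A spread family contains many pairwise disjoint members. -/
lemma exists_matching_of_spread {ι : Type*} {R : ℝ} {s M L : ℕ} (hs : 0 < s)
    (hM : 0 < M) (hR : 128 * s * M ≤ R) (hML : (2 ^ L * (5 / 8) ^ M : ℝ) ≤ 1 / 2)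
    {I : Finset ι} (hI : I.Nonempty) {τ : ι → Finset α}
    (h : IndexSpread R I τ) (hτ : ∀ i ∈ I, (τ i).card < 2 ^ L) :
    ∃ c : Fin s → ι, (∀ j, c j ∈ I) ∧
      ∀ j j', j ≠ j' → Disjoint (τ (c j)) (τ (c j')) := by
  classical
  set Ω : Finset α := I.biUnion τ with hΩ
  have hsub : ∀ i ∈ I, τ i ⊆ Ω := fun i hi x hx => Finset.mem_biUnion.2 ⟨i, hi, hx⟩
  -- With `2s` colours, each class failing with probability at most `1/2`, some colouring has `s`
  -- good classes. Hence `M` need not grow with `s`.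
  have hs2 : 0 < 2 * s := by omega
  obtain ⟨f, hf⟩ := exists_colouring_le hs2 Ω fun _ => miss (I.image τ)
  have hle : ∑ j, miss (I.image τ) (Ω.filter fun x => f x = j) ≤ s := by
    refine hf.trans (le_trans (Finset.sum_le_sum fun j _ =>
      (h.biasedMean_miss_le hs2 hM (by push_cast; linarith) hI
        fun i hi => ⟨hsub i hi, hτ i hi⟩).trans hML) ?_)
    simp only [Finset.sum_const, Finset.card_univ, Fintype.card_fin, nsmul_eq_mul]
    push_cast
    linarith
  set J : Finset (Fin (2 * s)) := Finset.univ.filter fun j =>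
    ∃ i ∈ I, τ i ⊆ Ω.filter fun x => f x = j with hJ
  have hJc : (s : ℝ) ≤ J.card := by
    have h1 : ∑ j, miss (I.image τ) (Ω.filter fun x => f x = j) = (Jᶜ.card : ℝ) := by
      rw [Finset.card_eq_sum_ones, Nat.cast_sum, ← Finset.sum_filter_add_sum_filter_not
        Finset.univ (fun j => ∃ i ∈ I, τ i ⊆ Ω.filter fun x => f x = j)]
      rw [Finset.sum_eq_zero, zero_add, hJ, Finset.compl_filter]
      · refine Finset.sum_congr rfl fun j hj => ?_
        rw [Nat.cast_one]
        refine if_neg ?_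
        rintro ⟨S, hS, hs⟩
        obtain ⟨i, hi, rfl⟩ := Finset.mem_image.1 hS
        exact (Finset.mem_filter.1 hj).2 ⟨i, hi, hs⟩
      · intro j hj
        obtain ⟨i, hi, hs⟩ := (Finset.mem_filter.1 hj).2
        exact if_pos ⟨τ i, Finset.mem_image_of_mem _ hi, hs⟩
    have h2 : J.card + Jᶜ.card = 2 * s := by
      rw [Finset.card_add_card_compl, Fintype.card_fin]
    have h3 : (J.card : ℝ) + Jᶜ.card = 2 * s := by exact_mod_cast h2
    linarith
  obtain ⟨e⟩ : Nonempty (Fin s ↪ J) := by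
    refine Function.Embedding.nonempty_of_card_le ?_
    rw [Fintype.card_fin, Fintype.card_coe]
    exact_mod_cast hJc
  have hex : ∀ a : Fin s, ∃ i ∈ I, τ i ⊆ Ω.filter fun x => f x = (e a : Fin (2 * s)) :=
    fun a => (Finset.mem_filter.1 (e a).2).2
  choose c hc hcs using hex
  refine ⟨c, hc, fun j j' hjj => Finset.disjoint_left.2 fun x hx hx' => hjj ?_⟩
  apply e.injective
  apply Subtype.ext
  rw [← (Finset.mem_filter.1 (hcs j hx)).2, (Finset.mem_filter.1 (hcs j' hx')).2]

/-! ### Spread approximation -/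

/-- A maximal set `B` lying in many `τ i`: above it the family is spread. -/
lemma exists_spread_core {ι : Type*} {R : ℝ} (hR : 0 < R) {I : Finset ι} (hI : I.Nonempty)
    (τ : ι → Finset α) :
    ∃ B : Finset α, (I.card : ℝ) ≤ (I.filter fun i => B ⊆ τ i).card * R ^ B.card ∧
      IndexSpread R (I.filter fun i => B ⊆ τ i) fun i => τ i \ B := by
  classical
  have hcard : (0 : ℝ) < I.card := by exact_mod_cast hI.card_pos
  have hmem : ∀ B : Finset α, (I.card : ℝ) ≤ (I.filter fun i => B ⊆ τ i).card * R ^ B.card →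
      B ∈ (I.biUnion τ).powerset.filter fun B =>
        (I.card : ℝ) ≤ (I.filter fun i => B ⊆ τ i).card * R ^ B.card := by
    intro B hB
    refine Finset.mem_filter.2 ⟨Finset.mem_powerset.2 ?_, hB⟩
    rcases (I.filter fun i => B ⊆ τ i).eq_empty_or_nonempty with he | ⟨i, hi⟩
    · rw [he] at hB
      simp only [Finset.card_empty, Nat.cast_zero, zero_mul] at hB
      linarith
    · rw [Finset.mem_filter] at hi
      exact hi.2.trans (Finset.subset_biUnion_of_mem τ hi.1)
  obtain ⟨B, hB, hmax⟩ := Finset.exists_max_image _ Finset.card ⟨∅, hmem ∅ (by simp)⟩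
  have hB' := (Finset.mem_filter.1 hB).2
  refine ⟨B, hB', fun X => ?_⟩
  rcases X.eq_empty_or_nonempty with rfl | hX
  · simp
  by_cases hd : Disjoint X B
  · have hle : ¬ (I.card : ℝ) ≤
        (I.filter fun i => X ∪ B ⊆ τ i).card * R ^ (X ∪ B).card := by
      intro h
      have h1 := hmax _ (hmem _ h)
      rw [Finset.card_union_of_disjoint hd] at h1
      have := hX.card_pos
      omega
    have hfil : ((I.filter fun i => B ⊆ τ i).filter fun i => X ⊆ τ i \ B).card ≤
        (I.filter fun i => X ∪ B ⊆ τ i).card := by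
      refine Finset.card_le_card fun i hi => ?_
      simp only [Finset.mem_filter] at hi ⊢
      exact ⟨hi.1.1, Finset.union_subset (hi.2.trans Finset.sdiff_subset) hi.1.2⟩
    have hfil' : (((I.filter fun i => B ⊆ τ i).filter fun i => X ⊆ τ i \ B).card : ℝ) ≤
        (I.filter fun i => X ∪ B ⊆ τ i).card := by exact_mod_cast hfil
    rw [Finset.card_union_of_disjoint hd, pow_add] at hle
    have hpos : 0 < R ^ B.card := by positivity
    refine le_of_mul_le_mul_right ?_ hpos
    calc _ ≤ ((I.filter fun i => X ∪ B ⊆ τ i).card : ℝ) * R ^ X.card * R ^ B.card := by gcongr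
      _ ≤ _ := by rw [mul_assoc]; exact (not_le.1 hle).le.trans hB'
  · have he : ((I.filter fun i => B ⊆ τ i).filter fun i => X ⊆ τ i \ B) = ∅ := by
      refine Finset.filter_false_of_mem fun i _ h => hd ?_
      exact Finset.disjoint_left.2 fun x hx hxB => (Finset.mem_sdiff.1 (h hx)).2 hxB
    rw [he]
    simp

/-- Spread approximation: outside a small remainder, `τ i` contains a set `β i` of size at
most `q` above which the family is spread. -/
lemma exists_spread_approximation {ι : Type*} [DecidableEq ι] {R : ℝ} (hR : 0 < R) (q : ℕ)
    (τ : ι → Finset α) (I : Finset ι) :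
    ∃ E ⊆ I, ∃ β : ι → Finset α, (∀ i ∈ I \ E, β i ⊆ τ i ∧ (β i).card ≤ q) ∧
      (∀ i ∈ I \ E,
        IndexSpread R ((I \ E).filter fun j => β j = β i) fun j => τ j \ β i) ∧
      (E = ∅ ∨ ∃ B : Finset α, q < B.card ∧
        (E.card : ℝ) ≤ (E.filter fun i => B ⊆ τ i).card * R ^ B.card) := by
  induction I using Finset.strongInduction with
  | H I ih =>
    rcases I.eq_empty_or_nonempty with rfl | hI
    · exact ⟨∅, subset_rfl, fun _ => ∅, by simp, by simp, Or.inl rfl⟩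
    obtain ⟨B, hB, hspread⟩ := exists_spread_core hR hI τ
    by_cases hq : q < B.card
    -- The peeling stops: all that is left becomes the remainder, witnessed by the large core `B`.
    · exact ⟨I, subset_rfl, fun _ => ∅, by simp, by simp, Or.inr ⟨B, hq, hB⟩⟩
    set J := I.filter fun i => B ⊆ τ i with hJ
    have hJI : J ⊆ I := Finset.filter_subset _ _
    have hJne : J.Nonempty := by
      rw [Finset.nonempty_iff_ne_empty]
      intro he
      rw [he] at hB
      have : (0 : ℝ) < I.card := by exact_mod_cast hI.card_pos
      simp only [Finset.card_empty, Nat.cast_zero, zero_mul] at hB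
      linarith
    obtain ⟨E, hE, β, h1, h2, h3⟩ := ih (I \ J) (Finset.sdiff_ssubset hJI hJne)
    have hEJ : ∀ i ∈ J, i ∉ E := fun i hi h => (Finset.mem_sdiff.1 (hE h)).2 hi
    have hmem : ∀ i, i ∈ I \ E → i ∉ J → i ∈ (I \ J) \ E := by
      intro i hi hiJ
      simp only [Finset.mem_sdiff] at hi ⊢
      exact ⟨⟨hi.1, hiJ⟩, hi.2⟩
    -- `J` takes every index whose set contains `B`, so `B` never recurs as a later core and the
    -- fibres of the new map are exactly the peeled families.
    have hβ : ∀ i, i ∈ I \ E → i ∉ J → β i ≠ B := by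
      intro i hi hiJ h
      refine hiJ (Finset.mem_filter.2 ⟨(Finset.mem_sdiff.1 hi).1, ?_⟩)
      rw [← h]
      exact (h1 i (hmem i hi hiJ)).1
    refine ⟨E, hE.trans Finset.sdiff_subset, fun i => if i ∈ J then B else β i, ?_, ?_, h3⟩
    · intro i hi
      by_cases hiJ : i ∈ J
      · simp only [hiJ, if_true]
        exact ⟨(Finset.mem_filter.1 hiJ).2, not_lt.1 hq⟩
      · simp only [hiJ, if_false]
        exact h1 i (hmem i hi hiJ)
    · intro i hi
      by_cases hiJ : i ∈ J
      · simp only [hiJ, if_true]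
        convert hspread using 1
        ext j
        rw [Finset.mem_filter]
        constructor
        · rintro ⟨hj, hjB⟩
          by_contra hjJ
          rw [if_neg hjJ] at hjB
          exact hβ j hj hjJ hjB
        · intro hj
          exact ⟨Finset.mem_sdiff.2 ⟨hJI hj, hEJ j hj⟩, if_pos hj⟩
      · simp only [hiJ, if_false]
        convert h2 i (hmem i hi hiJ) using 1
        ext j
        simp only [Finset.mem_filter]
        constructor
        · rintro ⟨hj, hjB⟩
          by_cases hjJ : j ∈ J
          · rw [if_pos hjJ] at hjB
            exact absurd hjB.symm (hβ i hi hiJ)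
          · rw [if_neg hjJ] at hjB
            exact ⟨hmem j hj hjJ, hjB⟩
        · rintro ⟨hj, hjB⟩
          simp only [Finset.mem_sdiff] at hj
          exact ⟨Finset.mem_sdiff.2 ⟨hj.1.1, hj.2⟩, by rw [if_neg hj.1.2]; exact hjB⟩

/-! ### Lifting intersection patterns -/

lemma IndexSpread.card_mem_mul_le {ι : Type*} {R : ℝ} {I : Finset ι} {τ : ι → Finset α}
    {B : Finset α} (h : IndexSpread R I fun i => τ i \ B) {x : α} (hx : x ∉ B) :
    ((I.filter fun i => x ∈ τ i).card : ℝ) * R ≤ I.card := by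
  simpa [hx] using h {x}

lemma card_biUnion_fin_le {s Q : ℕ} {B : Fin s → Finset α} (hB : ∀ j, (B j).card ≤ Q) :
    ((Finset.univ.biUnion B).card : ℝ) ≤ s * Q := by
  have := Finset.card_biUnion_le_card_mul Finset.univ B Q fun j _ => hB j
  rw [Finset.card_univ, Fintype.card_fin] at this
  exact_mod_cast this

/-- At most `|Y| / c` of a family meets `Y`, if each element has degree at most `1 / c`. -/
lemma card_meeting_mul_le {ι : Type*} {I : Finset ι} {τ : ι → Finset α} {Y : Finset α}
    {c : ℝ} (hc : 0 ≤ c) (h : ∀ x ∈ Y, ((I.filter fun i => x ∈ τ i).card : ℝ) * c ≤ I.card) :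
    ((I.filter fun i => ∃ x ∈ Y, x ∈ τ i).card : ℝ) * c ≤ Y.card * I.card := by
  classical
  have h1 : (I.filter fun i => ∃ x ∈ Y, x ∈ τ i) ⊆
      Y.biUnion fun x => I.filter fun i => x ∈ τ i := by
    intro i hi
    obtain ⟨hi, x, hx, hxi⟩ := Finset.mem_filter.1 hi
    exact Finset.mem_biUnion.2 ⟨x, hx, Finset.mem_filter.2 ⟨hi, hxi⟩⟩
  have h2 : ((I.filter fun i => ∃ x ∈ Y, x ∈ τ i).card : ℝ) ≤
      ∑ x ∈ Y, ((I.filter fun i => x ∈ τ i).card : ℝ) := by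
    exact_mod_cast (Finset.card_le_card h1).trans Finset.card_biUnion_le
  calc _ ≤ (∑ x ∈ Y, ((I.filter fun i => x ∈ τ i).card : ℝ)) * c :=
        mul_le_mul_of_nonneg_right h2 hc
    _ = ∑ x ∈ Y, ((I.filter fun i => x ∈ τ i).card : ℝ) * c := Finset.sum_mul _ _ _
    _ ≤ ∑ _x ∈ Y, (I.card : ℝ) := Finset.sum_le_sum h
    _ = _ := by rw [Finset.sum_const, nsmul_eq_mul]

/-- Sets `B j` can be enlarged to members of families above them without changing the pairwise
intersections, when no element outside `B j` has large degree. -/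
lemma exists_lift_of_degree_le {ι : Type*} {s Q : ℕ} {c : ℝ} (hc : (s * Q : ℝ) < c)
    {B : Fin s → Finset α} (hB : ∀ j, (B j).card ≤ Q) {I : Fin s → Finset ι}
    (hI : ∀ j, (I j).Nonempty) {τ : ι → Finset α}
    (hτ : ∀ j, ∀ i ∈ I j, B j ⊆ τ i ∧ (τ i).card ≤ Q)
    (hdeg : ∀ j, ∀ x ∉ B j, (((I j).filter fun i => x ∈ τ i).card : ℝ) * c ≤ (I j).card) :
    ∃ f : Fin s → ι, (∀ j, f j ∈ I j) ∧
      ∀ j j', j ≠ j' → τ (f j) ∩ τ (f j') = B j ∩ B j' := by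
  -- The sets are replaced one at a time; `J` records the positions already lifted.
  have key : ∀ J : Finset (Fin s), ∃ f : Fin s → ι, (∀ j, f j ∈ I j) ∧
      ∀ j j', j ≠ j' → (if j ∈ J then τ (f j) else B j) ∩ (if j' ∈ J then τ (f j') else B j') =
        B j ∩ B j' := by
    intro J
    induction J using Finset.induction_on with
    | empty => exact ⟨fun j => (hI j).choose, fun j => (hI j).choose_spec, by simp⟩
    | insert a J ha ih =>
      obtain ⟨f, hf, hint⟩ := ih
      set D : Fin s → Finset α := fun j => if j ∈ J then τ (f j) else B j with hD
      have hDcard : ∀ j, (D j).card ≤ Q := by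
        intro j
        simp only [hD]
        split_ifs
        · exact (hτ j _ (hf j)).2
        · exact hB j
      set Y := Finset.univ.biUnion D \ B a with hY
      have hYc : (Y.card : ℝ) ≤ s * Q :=
        le_trans (by exact_mod_cast Finset.card_le_card Finset.sdiff_subset)
          (card_biUnion_fin_le hDcard)
      have hc0 : 0 < c := lt_of_le_of_lt (by positivity) hc
      have hIa : (0 : ℝ) < (I a).card := by exact_mod_cast (hI a).card_pos
      have hmeet := card_meeting_mul_le hc0.le
        fun x (hx : x ∈ Y) => hdeg a x (Finset.mem_sdiff.1 hx).2
      -- The current sets cover at most `s Q < c` points, and each point outside `B a` lies in at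
      -- most a fraction `1 / c` of the members, so some member avoids them all.
      obtain ⟨i, hi, hiY⟩ : ∃ i ∈ I a, ¬ ∃ x ∈ Y, x ∈ τ i := by
        by_contra hcon
        push Not at hcon
        rw [Finset.filter_true_of_mem hcon] at hmeet
        nlinarith
      have hnew : ∀ j, j ≠ a → τ i ∩ D j = B a ∩ D j := by
        intro j _
        ext x
        simp only [Finset.mem_inter]
        refine ⟨fun ⟨hx, hxj⟩ => ⟨?_, hxj⟩, fun ⟨hx, hxj⟩ => ⟨(hτ a i hi).1 hx, hxj⟩⟩
        by_contra hxB
        exact hiY ⟨x, Finset.mem_sdiff.2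
          ⟨Finset.mem_biUnion.2 ⟨j, Finset.mem_univ _, hxj⟩, hxB⟩, hx⟩
      have hDa : D a = B a := if_neg ha
      have hint' : ∀ j j', j ≠ j' → D j ∩ D j' = B j ∩ B j' := hint
      have hupd : ∀ j, j ≠ a → (if j ∈ insert a J then τ (Function.update f a i j) else B j) =
          D j := by
        intro j hj
        rw [Function.update_of_ne hj]
        simp [hD, Finset.mem_insert, hj]
      have hupda : (if a ∈ insert a J then τ (Function.update f a i a) else B a) = τ i := by
        simp
      refine ⟨Function.update f a i, fun j => ?_, fun j j' hjj => ?_⟩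
      · by_cases hj : j = a
        · subst hj; simpa using hi
        · rw [Function.update_of_ne hj]; exact hf j
      · by_cases hj : j = a
        · subst hj
          rw [hupda, hupd j' hjj.symm, hnew j' hjj.symm]
          have h := hint' j j' hjj
          rwa [hDa] at h
        · by_cases hj' : j' = a
          · subst hj'
            rw [hupda, hupd j hj, Finset.inter_comm, hnew j hj, Finset.inter_comm]
            have h := hint' j j' hjj
            rwa [hDa] at h
          · rw [hupd j hj, hupd j' hj']
            exact hint' j j' hjj
  obtain ⟨f, hf, h⟩ := key Finset.univ
  exact ⟨f, hf, by simpa using h⟩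

/-- The same for spread families of sets that may be very large. -/
lemma exists_lift_of_spread {ι : Type*} {s Q M L : ℕ} {R : ℝ} (hs : 0 < s) (hM : 0 < M)
    (hR : 0 < R) (hQR : 2 * (s * Q) ≤ R) (hMR : 64 * s * M ≤ R / 2)
    (hML : (s : ℝ) * (2 ^ L * (5 / 8) ^ M) < 1)
    {B : Fin s → Finset α} (hB : ∀ j, (B j).card ≤ Q) {I : Fin s → Finset ι}
    (hI : ∀ j, (I j).Nonempty) {τ : ι → Finset α}
    (hτ : ∀ j, ∀ i ∈ I j, B j ⊆ τ i ∧ (τ i).card < 2 ^ L)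
    (hspread : ∀ j, IndexSpread R (I j) fun i => τ i \ B j) :
    ∃ f : Fin s → ι, (∀ j, f j ∈ I j) ∧
      ∀ j j', j ≠ j' → τ (f j) ∩ τ (f j') = B j ∩ B j' := by
  set Y := Finset.univ.biUnion B with hY
  have hYc : (Y.card : ℝ) ≤ s * Q := card_biUnion_fin_le hB
  -- Members meeting another `B j'` outside `B j` are discarded. They are at most half, since `2 s Q
  -- ≤ R`; for nonempty `X` the loss is absorbed by `2 ≤ 2 ^ |X|`, so `R / 2`-spreadness survives.
  set I' : Fin s → Finset ι := fun j => (I j).filter fun i => ¬ ∃ x ∈ Y \ B j, x ∈ τ i with hI'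
  have hhalf : ∀ j, ((I j).card : ℝ) ≤ 2 * (I' j).card := by
    intro j
    have h1 := card_meeting_mul_le hR.le (Y := Y \ B j)
      fun x hx => (hspread j).card_mem_mul_le (Finset.mem_sdiff.1 hx).2
    have h2 : ((Y \ B j).card : ℝ) ≤ s * Q :=
      le_trans (by exact_mod_cast Finset.card_le_card Finset.sdiff_subset) hYc
    have h3 : (((I j).filter fun i => ∃ x ∈ Y \ B j, x ∈ τ i).card : ℝ) + (I' j).card =
        (I j).card := by
      exact_mod_cast Finset.card_filter_add_card_filter_not _
    have h4 : (((I j).filter fun i => ∃ x ∈ Y \ B j, x ∈ τ i).card : ℝ) * R ≤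
        (I j).card / 2 * R := by
      have : (0 : ℝ) ≤ (I j).card := by positivity
      nlinarith
    have h5 := le_of_mul_le_mul_right h4 hR
    linarith
  have hne : ∀ j, (I' j).Nonempty := by
    intro j
    have h1 : (0 : ℝ) < (I j).card := by exact_mod_cast (hI j).card_pos
    have h2 : (0 : ℝ) < (I' j).card := by linarith [hhalf j]
    exact Finset.card_pos.1 (by exact_mod_cast h2)
  have hspread' : ∀ j, IndexSpread (R / 2) (I' j) fun i => τ i \ B j := by
    intro j X
    rcases X.eq_empty_or_nonempty with rfl | hX
    · simp
    have h1 : (((I' j).filter fun i => X ⊆ τ i \ B j).card : ℝ) ≤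
        ((I j).filter fun i => X ⊆ τ i \ B j).card := by
      exact_mod_cast Finset.card_le_card
        (Finset.filter_subset_filter _ (Finset.filter_subset _ _))
    have h2 : (2 : ℝ) ≤ 2 ^ X.card := le_self_pow₀ (by norm_num) hX.card_pos.ne'
    rw [div_pow, mul_div_assoc', div_le_iff₀ (by positivity)]
    calc _ ≤ (((I j).filter fun i => X ⊆ τ i \ B j).card : ℝ) * R ^ X.card := by gcongr
      _ ≤ (I j).card := hspread j X
      _ ≤ 2 * (I' j).card := hhalf j
      _ ≤ (I' j).card * 2 ^ X.card := by rw [mul_comm]; gcongr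
  obtain ⟨f, hf, hdis⟩ := exists_pairwise_disjoint_of_spread hs hM hMR hML hne hspread'
    fun j i hi => (Finset.card_le_card Finset.sdiff_subset).trans_lt
      (hτ j i (Finset.mem_filter.1 hi).1).2
  refine ⟨f, fun j => (Finset.mem_filter.1 (hf j)).1, fun j j' hjj => ?_⟩
  have hin : ∀ j, ∀ x ∈ τ (f j), x ∈ Y → x ∈ B j := by
    intro j x hx hxY
    by_contra hxB
    exact (Finset.mem_filter.1 (hf j)).2 ⟨x, Finset.mem_sdiff.2 ⟨hxY, hxB⟩, hx⟩
  have hBY : ∀ j, B j ⊆ Y := fun j => Finset.subset_biUnion_of_mem B (Finset.mem_univ j)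
  ext x
  simp only [Finset.mem_inter]
  constructor
  · rintro ⟨hx, hx'⟩
    by_cases hxY : x ∈ Y
    · exact ⟨hin j x hx hxY, hin j' x hx' hxY⟩
    · exact absurd (Finset.mem_sdiff.2 ⟨hx', fun h => hxY (hBY j' h)⟩)
        (Finset.disjoint_left.1 (hdis j j' hjj)
          (Finset.mem_sdiff.2 ⟨hx, fun h => hxY (hBY j h)⟩))
  · rintro ⟨hx, hx'⟩
    exact ⟨(hτ j _ (Finset.mem_filter.1 (hf j)).1).1 hx,
      (hτ j' _ (Finset.mem_filter.1 (hf j')).1).1 hx'⟩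

/-! ### Local spreadness and weak sunflowers -/

lemma card_link (𝓐 : Finset (Finset α)) (B : Finset α) :
    (link 𝓐 B).card = (𝓐.filter fun F => B ⊆ F).card := by
  unfold link restriction
  rw [Finset.card_image_of_injOn]
  · simp only [Finset.inter_eq_right]
  · intro F hF F' hF' h
    simp only [Finset.coe_filter, Set.mem_ofPred_eq, Finset.inter_eq_right] at hF hF'
    rw [← Finset.sdiff_union_of_subset hF.2, show F \ B = F' \ B from h,
      Finset.sdiff_union_of_subset hF'.2]

/-- Pick a `t`-subset `T` of `B` and use spreadness of `𝓐(T)` at `B \ T`. -/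
lemma card_above_mul_pow_le {r : ℝ} (hr : 0 < r) {t : ℕ} {𝓐 : Finset (Finset α)}
    (h : IsLocallySpread r t 𝓐) {B : Finset α} (hB : t ≤ B.card) :
    ((𝓐.filter fun F => B ⊆ F).card : ℝ) * r ^ (B.card - t) ≤ maxLink t 𝓐 := by
  rcases (𝓐.filter fun F => B ⊆ F).eq_empty_or_nonempty with he | ⟨F₀, hF₀⟩
  · rw [he]; simp
  obtain ⟨hF₀, hBF₀⟩ := Finset.mem_filter.1 hF₀
  obtain ⟨T, hTB, hT⟩ := Finset.exists_subset_card_eq hB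
  have hTl : T ∈ layerShadow t 𝓐 :=
    Finset.mem_biUnion.2 ⟨F₀, hF₀, Finset.mem_powersetCard.2 ⟨hTB.trans hBF₀, hT⟩⟩
  have hTs : T ∈ lowerShadow t 𝓐 :=
    Finset.mem_biUnion.2 ⟨t, Finset.mem_range.2 (Nat.lt_succ_self t), hTl⟩
  have h1 := h T hTs (B \ T)
  have hBT : (B \ T).card = B.card - t := by rw [Finset.card_sdiff_of_subset hTB, hT]
  rw [card_link, hBT, zpow_neg, zpow_natCast, ← div_eq_inv_mul, le_div_iff₀ (by positivity)] at h1
  have h2 : (𝓐.filter fun F => B ⊆ F).card ≤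
      ((link 𝓐 T).filter fun G => B \ T ⊆ G).card := by
    refine Finset.card_le_card_of_injOn (fun F => F \ T) ?_ ?_
    · intro F hF
      simp only [Finset.coe_filter, Set.mem_ofPred_eq] at hF ⊢
      refine ⟨Finset.mem_image.2 ⟨F, Finset.mem_filter.2 ⟨hF.1, ?_⟩, rfl⟩,
        Finset.sdiff_subset_sdiff hF.2 subset_rfl⟩
      exact Finset.inter_eq_right.2 (hTB.trans hF.2)
    · intro F hF F' hF' h
      simp only [Finset.coe_filter, Set.mem_ofPred_eq] at hF hF'
      rw [← Finset.sdiff_union_of_subset (hTB.trans hF.2), show F \ T = F' \ T from h,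
        Finset.sdiff_union_of_subset (hTB.trans hF'.2)]
  have h3 : (link 𝓐 T).card ≤ maxLink t 𝓐 :=
    Finset.le_sup (f := fun T => (link 𝓐 T).card) hTl
  have h2' : ((𝓐.filter fun F => B ⊆ F).card : ℝ) ≤
      ((link 𝓐 T).filter fun G => B \ T ⊆ G).card := by exact_mod_cast h2
  have h3' : ((link 𝓐 T).card : ℝ) ≤ maxLink t 𝓐 := by exact_mod_cast h3
  calc _ ≤ (((link 𝓐 T).filter fun G => B \ T ⊆ G).card : ℝ) * r ^ (B.card - t) := by gcongr
    _ ≤ _ := h1.trans h3'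

/-- No `s` members `τ i` have all their pairwise intersections equal to one set of size less
than `t`. -/
def NoSmallCore {ι : Type*} (s t : ℕ) (I : Finset ι) (τ : ι → Finset α) : Prop :=
  ∀ f : Fin s → ι, (∀ j, f j ∈ I) → ∀ C : Finset α, C.card < t →
    ¬ ∀ j j', j ≠ j' → τ (f j) ∩ τ (f j') = C

/-- Sets strictly larger than their common pairwise intersection cannot coincide; this recovers
distinctness from the weak form. -/
lemma isSunflower_of_inter_eq {s : ℕ} (hs : 2 ≤ s) {F : Fin s → Finset α} {C : Finset α}
    (hF : ∀ j, C.card < (F j).card) (h : ∀ j j', j ≠ j' → F j ∩ F j' = C) :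
    IsSunflower s F C := by
  refine ⟨fun i j hij => ?_, ?_, h⟩
  · by_contra hne
    have := h i j hne
    rw [hij, Finset.inter_self] at this
    exact absurd (hF j) (by rw [this]; exact lt_irrefl _)
  · have hlt : (⟨0, by omega⟩ : Fin s) ≠ ⟨1, by omega⟩ := by simp
    ext x
    simp only [Set.mem_iInter, Finset.mem_coe]
    constructor
    · intro hx u
      obtain ⟨v, hv⟩ : ∃ v, u ≠ v := by
        by_cases hu : u = ⟨0, by omega⟩
        · exact ⟨⟨1, by omega⟩, hu ▸ hlt⟩
        · exact ⟨_, hu⟩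
      rw [← h u v hv] at hx
      exact (Finset.mem_inter.1 hx).1
    · intro hx
      rw [← h _ _ hlt]
      exact Finset.mem_inter.2 ⟨hx _, hx _⟩

lemma noSmallCore_of_not_hasSunflowerCoreLE {s t k : ℕ} (hs : 2 ≤ s) (htk : t ≤ k)
    {𝓕 : Finset (Finset α)} (hunif : ∀ F ∈ 𝓕, F.card = k)
    (h : ¬ HasSunflowerCoreLE s (t - 1) 𝓕) : NoSmallCore s t 𝓕 id := by
  intro F hF C hC hint
  exact h ⟨F, C, hF, isSunflower_of_inter_eq hs
    (fun j => by rw [hunif _ (hF j)]; omega) hint, by omega⟩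

/-- Two distinct `t`-sets meet in fewer than `t` points, so every core is automatically small. -/
lemma not_hasSunflower_of_noSmallCore {s t : ℕ} (hs : 2 ≤ s) {𝓣 : Finset (Finset α)}
    (hunif : ∀ T ∈ 𝓣, T.card = t) (h : NoSmallCore s t 𝓣 id) : ¬ HasSunflower s 𝓣 := by
  rintro ⟨F, C, hF, hsun⟩
  refine h F hF C ?_ hsun.inter_eq
  have hne : F ⟨0, by omega⟩ ≠ F ⟨1, by omega⟩ := fun h => by
    simpa using hsun.distinct h
  have hC := hsun.inter_eq ⟨0, by omega⟩ ⟨1, by omega⟩ (by simp)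
  rw [← hC]
  by_contra hle
  rw [not_lt] at hle
  have h0 := hunif _ (hF ⟨0, by omega⟩)
  have h1 := hunif _ (hF ⟨1, by omega⟩)
  have e0 := Finset.eq_of_subset_of_card_le Finset.inter_subset_left (h0.le.trans hle)
  have e1 := Finset.eq_of_subset_of_card_le Finset.inter_subset_right (h1.le.trans hle)
  exact hne (e0.symm.trans e1)

/-- Lifting of weak sunflowers preserves their absence. -/
lemma NoSmallCore.of_lift {ι κ : Type*} {s t : ℕ} {I : Finset ι} {τ : ι → Finset α}
    {J : Finset κ} {σ : κ → Finset α} (h : NoSmallCore s t I τ)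
    (hlift : ∀ g : Fin s → κ, (∀ j, g j ∈ J) → ∃ f : Fin s → ι, (∀ j, f j ∈ I) ∧
      ∀ j j', j ≠ j' → τ (f j) ∩ τ (f j') = σ (g j) ∩ σ (g j')) :
    NoSmallCore s t J σ := by
  intro g hg C hC hint
  obtain ⟨f, hf, hfg⟩ := hlift g hg
  exact h f hf C hC fun j j' hjj => (hfg j j' hjj).trans (hint j j' hjj)

/-- Controls every remainder with a core of size at least `t`: sets `F` with `B ⊆ σ F ⊆ F` lie above
`B` in `𝓐`, where local spreadness counts them. -/
lemma card_le_of_core_large {r R e : ℝ} (hr : 0 < r) (hR : 0 ≤ R) {t : ℕ}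
    {𝓐 E : Finset (Finset α)} (h : IsLocallySpread r t 𝓐) (hE : E ⊆ 𝓐)
    {σ : Finset α → Finset α} (hσ : ∀ F ∈ E, σ F ⊆ F) {B : Finset α} (hB : t ≤ B.card)
    (hcard : (E.card : ℝ) ≤ (E.filter fun F => B ⊆ σ F).card * R ^ B.card)
    (he : R ^ B.card ≤ e * r ^ (B.card - t)) :
    (E.card : ℝ) ≤ e * maxLink t 𝓐 := by
  have h1 : ((E.filter fun F => B ⊆ σ F).card : ℝ) ≤ (𝓐.filter fun F => B ⊆ F).card := by
    refine Nat.cast_le.2 (Finset.card_le_card fun F hF => ?_)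
    rw [Finset.mem_filter] at hF ⊢
    exact ⟨hE hF.1, hF.2.trans (hσ F hF.1)⟩
  have h2 := card_above_mul_pow_le hr h hB
  have he0 : 0 ≤ e := by
    by_contra hneg
    have : e * r ^ (B.card - t) < 0 := mul_neg_of_neg_of_pos (not_le.1 hneg) (by positivity)
    have : 0 ≤ R ^ B.card := by positivity
    linarith
  calc (E.card : ℝ) ≤ (𝓐.filter fun F => B ⊆ F).card * (e * r ^ (B.card - t)) :=
        hcard.trans (mul_le_mul h1 he (by positivity) (by positivity))
    _ = e * ((𝓐.filter fun F => B ⊆ F).card * r ^ (B.card - t)) := by ring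
    _ ≤ _ := mul_le_mul_of_nonneg_left h2 he0

/-! ### The three-stage reduction -/

/-- The structural part of the theorem, with all numerical requirements as hypotheses. -/
lemma exists_layerShadow_cover {s t k : ℕ} {r R₁ R₂ R₃ θ e₁ e₂ e₃ : ℝ} {q₁ q₂ L₁ M₁ L₃ M₃ : ℕ}
    (hs : 2 ≤ s) (hr : 0 < r) (hθ : 0 ≤ θ)
    (hq₁ : t ≤ q₁) (hq₂ : t ≤ q₂) (hR₁ : 0 < R₁) (hM₁ : 0 < M₁)
    (hQR₁ : 2 * (s * q₁) ≤ R₁) (hMR₁ : 64 * s * M₁ ≤ R₁ / 2)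
    (hML₁ : (s : ℝ) * (2 ^ L₁ * (5 / 8) ^ M₁) < 1) (hkL : k < 2 ^ L₁)
    (hR₂ : (s * q₁ : ℝ) < R₂) (hθr : (s * q₁ : ℝ) < θ * r)
    (hR₃ : 0 < R₃) (hM₃ : 0 < M₃) (hMR₃ : 128 * s * M₃ ≤ R₃)
    (hML₃ : (2 ^ L₃ * (5 / 8) ^ M₃ : ℝ) ≤ 1 / 2) (hqL : q₂ < 2 ^ L₃)
    (he₁ : ∀ b, q₁ < b → R₁ ^ b ≤ e₁ * r ^ (b - t))
    (he₂ : ∀ b, q₂ < b → R₂ ^ b ≤ e₂ * r ^ (b - t))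
    (he₃ : ∀ b, t < b → R₃ ^ b ≤ e₃ * r ^ (b - t)) (hθe : R₃ ^ t * θ ≤ e₃)
    {𝓐 : Finset (Finset α)} (hunif : ∀ F ∈ 𝓐, F.card = k) (hspread : IsLocallySpread r t 𝓐)
    {𝓕 : Finset (Finset α)} (hsub : 𝓕 ⊆ 𝓐) (hfree : NoSmallCore s t 𝓕 id) :
    ∃ 𝓣 ⊆ layerShadow t 𝓐, NoSmallCore s t 𝓣 id ∧
      ((𝓕 \ above 𝓕 𝓣).card : ℝ) ≤ (e₁ + e₂ + e₃) * maxLink t 𝓐 := by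
  have hs0 : 0 < s := by omega
  have hsq : (0 : ℝ) ≤ s * q₁ := by positivity
  have hR₂0 : 0 < R₂ := hsq.trans_lt hR₂
  have he₁0 : 0 ≤ e₁ := by
    have h1 := he₁ _ (Nat.lt_succ_self q₁)
    have h2 : 0 < R₁ ^ q₁.succ := by positivity
    exact (pos_of_mul_pos_left (h2.trans_le h1) (by positivity)).le
  have he₂0 : 0 ≤ e₂ := by
    have h1 := he₂ _ (Nat.lt_succ_self q₂)
    have h2 : 0 < R₂ ^ q₂.succ := by positivity
    exact (pos_of_mul_pos_left (h2.trans_le h1) (by positivity)).le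
  have hA : (0 : ℝ) ≤ maxLink t 𝓐 := by positivity
  -- first approximation
  obtain ⟨E₁, hE₁, σ₁, h₁sub, h₁spread, h₁rem⟩ := exists_spread_approximation hR₁ q₁ id 𝓕
  set 𝓖₁ := 𝓕 \ E₁ with h𝓖₁
  have h₁free : NoSmallCore s t 𝓖₁ σ₁ := by
    refine hfree.of_lift fun g hg => ?_
    have hmem : ∀ j, ∀ F ∈ 𝓖₁.filter fun F => σ₁ F = σ₁ (g j),
        σ₁ (g j) ⊆ id F ∧ (id F).card < 2 ^ L₁ := by
      intro j F hF
      rw [Finset.mem_filter] at hF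
      rw [← hF.2]
      refine ⟨(h₁sub F hF.1).1, ?_⟩
      rw [id, hunif F (hsub (Finset.sdiff_subset hF.1))]
      exact hkL
    obtain ⟨f, hf, hfg⟩ := exists_lift_of_spread hs0 hM₁ hR₁ hQR₁ hMR₁ hML₁
      (B := fun j => σ₁ (g j)) (fun j => (h₁sub _ (hg j)).2)
      (I := fun j => 𝓖₁.filter fun F => σ₁ F = σ₁ (g j))
      (fun j => ⟨g j, Finset.mem_filter.2 ⟨hg j, rfl⟩⟩) (τ := id) hmem
      (fun j => h₁spread _ (hg j))
    exact ⟨f, fun j => Finset.sdiff_subset (Finset.mem_filter.1 (hf j)).1, hfg⟩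
  -- second approximation
  obtain ⟨E₂, hE₂, σ₂, h₂sub, h₂spread, h₂rem⟩ := exists_spread_approximation hR₂0 q₂ σ₁ 𝓖₁
  set 𝓖₂ := 𝓖₁ \ E₂ with h𝓖₂
  have h₂₁ : 𝓖₂ ⊆ 𝓖₁ := Finset.sdiff_subset
  have h₂card : ∀ F ∈ 𝓖₂, (σ₂ F).card ≤ q₁ := fun F hF =>
    (Finset.card_le_card (h₂sub F hF).1).trans (h₁sub F (h₂₁ hF)).2
  have h₂F : ∀ F ∈ 𝓖₂, σ₂ F ⊆ F := fun F hF => (h₂sub F hF).1.trans (h₁sub F (h₂₁ hF)).1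
  have h₂𝓐 : 𝓖₂ ⊆ 𝓐 := h₂₁.trans (Finset.sdiff_subset.trans hsub)
  have h₂free : NoSmallCore s t 𝓖₂ σ₂ := by
    refine h₁free.of_lift fun g hg => ?_
    have hmem : ∀ j, ∀ F ∈ 𝓖₂.filter fun F => σ₂ F = σ₂ (g j),
        σ₂ (g j) ⊆ σ₁ F ∧ (σ₁ F).card ≤ q₁ := by
      intro j F hF
      rw [Finset.mem_filter] at hF
      rw [← hF.2]
      exact ⟨(h₂sub F hF.1).1, (h₁sub F (h₂₁ hF.1)).2⟩
    obtain ⟨f, hf, hfg⟩ := exists_lift_of_degree_le hR₂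
      (B := fun j => σ₂ (g j)) (fun j => h₂card _ (hg j))
      (I := fun j => 𝓖₂.filter fun F => σ₂ F = σ₂ (g j))
      (fun j => ⟨g j, Finset.mem_filter.2 ⟨hg j, rfl⟩⟩) (τ := σ₁) hmem
      (fun j x hx => (h₂spread _ (hg j)).card_mem_mul_le hx)
    exact ⟨f, fun j => h₂₁ (Finset.mem_filter.1 (hf j)).1, hfg⟩
  -- the family of heavy `t`-sets
  set 𝓣 := (layerShadow t 𝓐).filter fun B =>
    θ * maxLink t 𝓐 < ((𝓖₂.filter fun F => B ⊆ σ₂ F).card : ℝ) with h𝓣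
  have h𝓣card : ∀ B ∈ 𝓣, B.card = t := by
    intro B hB
    obtain ⟨F, -, hBF⟩ := Finset.mem_biUnion.1 (Finset.mem_filter.1 hB).1
    exact (Finset.mem_powersetCard.1 hBF).2
  have h𝓣free : NoSmallCore s t 𝓣 id := by
    refine h₂free.of_lift fun g hg => ?_
    have hne : ∀ j, (𝓖₂.filter fun F => g j ⊆ σ₂ F).Nonempty := by
      intro j
      have h1 := (Finset.mem_filter.1 (hg j)).2
      have h2 : (0 : ℝ) < ((𝓖₂.filter fun F => g j ⊆ σ₂ F).card : ℝ) :=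
        (mul_nonneg hθ hA).trans_lt h1
      exact Finset.card_pos.1 (by exact_mod_cast h2)
    have hmem : ∀ j, ∀ F ∈ 𝓖₂.filter fun F => g j ⊆ σ₂ F,
        g j ⊆ σ₂ F ∧ (σ₂ F).card ≤ q₁ := by
      intro j F hF
      rw [Finset.mem_filter] at hF
      exact ⟨hF.2, h₂card F hF.1⟩
    -- Adding `x` gives a `(t + 1)`-set, above which `𝓐` has at most `A_t / r` members, while a
    -- heavy set has more than `θ A_t`; the ratio is below `1 / (θ r)`.
    have hdeg : ∀ j, ∀ x ∉ g j,
        (((𝓖₂.filter fun F => g j ⊆ σ₂ F).filter fun F => x ∈ σ₂ F).card : ℝ) * (θ * r) ≤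
          (𝓖₂.filter fun F => g j ⊆ σ₂ F).card := by
      intro j x hx
      have hc : (insert x (g j)).card = t + 1 := by
        rw [Finset.card_insert_of_notMem hx, h𝓣card _ (hg j)]
      have h1 := card_above_mul_pow_le hr hspread (B := insert x (g j)) (by omega)
      rw [hc, Nat.add_sub_cancel_left, pow_one] at h1
      have h2 : (((𝓖₂.filter fun F => g j ⊆ σ₂ F).filter fun F => x ∈ σ₂ F).card : ℝ) ≤
          (𝓐.filter fun F => insert x (g j) ⊆ F).card := by
        refine Nat.cast_le.2 (Finset.card_le_card fun F hF => ?_)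
        simp only [Finset.mem_filter] at hF ⊢
        exact ⟨h₂𝓐 hF.1.1, (Finset.insert_subset hF.2 hF.1.2).trans (h₂F F hF.1.1)⟩
      have h3 := (Finset.mem_filter.1 (hg j)).2
      calc _ ≤ ((𝓐.filter fun F => insert x (g j) ⊆ F).card : ℝ) * (θ * r) := by gcongr
        _ = θ * (((𝓐.filter fun F => insert x (g j) ⊆ F).card : ℝ) * r) := by ring
        _ ≤ θ * maxLink t 𝓐 := by gcongr
        _ ≤ _ := h3.le
    obtain ⟨f, hf, hfg⟩ := exists_lift_of_degree_le hθr
      (B := g) (fun j => (h𝓣card _ (hg j)).le.trans hq₁) hne hmem hdeg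
    exact ⟨f, fun j => (Finset.mem_filter.1 (hf j)).1, hfg⟩
  refine ⟨𝓣, Finset.filter_subset _ _, h𝓣free, ?_⟩
  -- the remainders
  have hE₁card : (E₁.card : ℝ) ≤ e₁ * maxLink t 𝓐 := by
    rcases h₁rem with rfl | ⟨B, hqB, hB⟩
    · simpa using mul_nonneg he₁0 hA
    · exact card_le_of_core_large hr hR₁.le hspread (hE₁.trans hsub) (fun F _ => subset_rfl)
        (hq₁.trans hqB.le) hB (he₁ _ hqB)
  have hE₂card : (E₂.card : ℝ) ≤ e₂ * maxLink t 𝓐 := by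
    rcases h₂rem with rfl | ⟨B, hqB, hB⟩
    · simpa using mul_nonneg he₂0 hA
    · exact card_le_of_core_large hr hR₂0.le hspread
        (hE₂.trans (Finset.sdiff_subset.trans hsub)) (fun F hF => (h₁sub F (hE₂ hF)).1)
        (hq₂.trans hqB.le) hB (he₂ _ hqB)
  set E₃ := 𝓖₂.filter fun F => ¬ ∃ B ∈ 𝓣, B ⊆ σ₂ F with hE₃
  have h₃₂ : E₃ ⊆ 𝓖₂ := Finset.filter_subset _ _
  have hE₃card : (E₃.card : ℝ) ≤ e₃ * maxLink t 𝓐 := by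
    have he₃0 : 0 ≤ e₃ := le_trans (by positivity) hθe
    rcases E₃.eq_empty_or_nonempty with he | hne
    · rw [he]; simpa using mul_nonneg he₃0 hA
    obtain ⟨B, hB, hBs⟩ := exists_spread_core hR₃ hne σ₂
    have hJne : (E₃.filter fun F => B ⊆ σ₂ F).Nonempty := by
      rw [Finset.nonempty_iff_ne_empty]
      intro he
      rw [he] at hB
      have : (0 : ℝ) < E₃.card := by exact_mod_cast hne.card_pos
      simp only [Finset.card_empty, Nat.cast_zero, zero_mul] at hB
      linarith
    rcases lt_trichotomy B.card t with hlt | heq | hgt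
    -- Sets disjoint outside `B` form a weak sunflower with core `B`, which is forbidden. Their size
    -- is at most `q₂`, so only `log q₂` enters `R₃`.
    · obtain ⟨c, hc, hdis⟩ := exists_matching_of_spread hs0 hM₃ hMR₃ hML₃ hJne hBs
        fun F hF => ((Finset.card_le_card Finset.sdiff_subset).trans
          (h₂sub F (h₃₂ (Finset.mem_filter.1 hF).1)).2).trans_lt hqL
      refine absurd (fun j j' hjj => ?_) (h₂free c
        (fun j => h₃₂ (Finset.mem_filter.1 (hc j)).1) B hlt)
      have hBc : ∀ j, B ⊆ σ₂ (c j) := fun j => (Finset.mem_filter.1 (hc j)).2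
      refine Finset.Subset.antisymm (fun x hx => ?_) (Finset.subset_inter (hBc j) (hBc j'))
      rw [Finset.mem_inter] at hx
      by_contra hxB
      exact Finset.disjoint_left.1 (hdis j j' hjj) (Finset.mem_sdiff.2 ⟨hx.1, hxB⟩)
        (Finset.mem_sdiff.2 ⟨hx.2, hxB⟩)
    · obtain ⟨F, hF⟩ := hJne
      obtain ⟨hFE, hBF⟩ := Finset.mem_filter.1 hF
      have hB𝓣 : B ∉ 𝓣 := fun h => (Finset.mem_filter.1 hFE).2 ⟨B, h, hBF⟩
      have hBl : B ∈ layerShadow t 𝓐 := Finset.mem_biUnion.2 ⟨F, h₂𝓐 (h₃₂ hFE),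
        Finset.mem_powersetCard.2 ⟨hBF.trans (h₂F F (h₃₂ hFE)), heq⟩⟩
      have h1 : ((𝓖₂.filter fun F => B ⊆ σ₂ F).card : ℝ) ≤ θ * maxLink t 𝓐 :=
        not_lt.1 fun h => hB𝓣 (Finset.mem_filter.2 ⟨hBl, h⟩)
      have h2 : ((E₃.filter fun F => B ⊆ σ₂ F).card : ℝ) ≤
          (𝓖₂.filter fun F => B ⊆ σ₂ F).card := by
        exact_mod_cast Finset.card_le_card (Finset.filter_subset_filter _ h₃₂)
      rw [heq] at hB
      calc (E₃.card : ℝ) ≤ θ * maxLink t 𝓐 * R₃ ^ t :=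
            hB.trans (mul_le_mul_of_nonneg_right (h2.trans h1) (by positivity))
        _ = R₃ ^ t * θ * maxLink t 𝓐 := by ring
        _ ≤ _ := mul_le_mul_of_nonneg_right hθe hA
    · exact card_le_of_core_large hr hR₃.le hspread (h₃₂.trans h₂𝓐)
        (fun F hF => h₂F F (h₃₂ hF)) hgt.le hB (he₃ _ hgt)
  have hcover : 𝓕 \ above 𝓕 𝓣 ⊆ E₁ ∪ E₂ ∪ E₃ := by
    intro F hF
    obtain ⟨hF, hnot⟩ := Finset.mem_sdiff.1 hF
    by_cases h1 : F ∈ E₁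
    · exact Finset.mem_union_left _ (Finset.mem_union_left _ h1)
    by_cases h2 : F ∈ E₂
    · exact Finset.mem_union_left _ (Finset.mem_union_right _ h2)
    have hF₂ : F ∈ 𝓖₂ := Finset.mem_sdiff.2 ⟨Finset.mem_sdiff.2 ⟨hF, h1⟩, h2⟩
    refine Finset.mem_union_right _ (Finset.mem_filter.2 ⟨hF₂, ?_⟩)
    rintro ⟨B, hB, hBF⟩
    exact hnot (Finset.mem_filter.2 ⟨hF, B, hB, hBF.trans (h₂F F hF₂)⟩)
  have h1 := (Finset.card_le_card hcover).trans
    ((Finset.card_union_le _ _).trans (Nat.add_le_add_right (Finset.card_union_le _ _) _))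
  have h2 : ((𝓕 \ above 𝓕 𝓣).card : ℝ) ≤ E₁.card + E₂.card + E₃.card := by exact_mod_cast h1
  linarith

/-! ### Numerical estimates -/

lemma two_pow_mul_pow_le (L a : ℕ) :
    (2 ^ L * (5 / 8) ^ (2 * (L + a)) : ℝ) ≤ (1 / 2) ^ a := by
  have h1 : (2 ^ L * (5 / 8) ^ (2 * (L + a)) : ℝ) = (25 / 32) ^ L * (25 / 64) ^ a := by
    rw [pow_mul, pow_add, ← mul_assoc, ← mul_pow]
    norm_num
  rw [h1]
  calc ((25 / 32) ^ L * (25 / 64) ^ a : ℝ) ≤ 1 * (1 / 2) ^ a :=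
        mul_le_mul (pow_le_one₀ (by norm_num) (by norm_num))
          (pow_le_pow_left₀ (by norm_num) (by norm_num) a) (by positivity) (by norm_num)
    _ = _ := one_mul _

lemma logb_two_sq_le {x : ℝ} (hx : 1 ≤ x) : Real.logb 2 x ^ 2 ≤ 9 * x := by
  have hx0 : 0 ≤ x := by linarith
  have h1 : Real.log x ≤ 2 * √x := by
    have := Real.log_le_self (Real.sqrt_nonneg x)
    rw [Real.log_sqrt hx0] at this
    linarith
  have h2 := Real.log_two_gt_d9
  have h3 : Real.logb 2 x ≤ 3 * √x := by
    rw [Real.logb, div_le_iff₀ (by linarith)]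
    nlinarith [Real.sqrt_nonneg x]
  calc Real.logb 2 x ^ 2 ≤ (3 * √x) ^ 2 :=
        pow_le_pow_left₀ (Real.logb_nonneg (by norm_num) hx) h3 2
    _ = 9 * x := by rw [mul_pow, Real.sq_sqrt hx0]; norm_num

lemma one_le_logb_two {n : ℕ} (hn : 2 ≤ n) : 1 ≤ Real.logb 2 (n : ℝ) := by
  rw [Real.le_logb_iff_rpow_le (by norm_num) (by positivity), Real.rpow_one]
  exact_mod_cast hn

/-- Since `R ≤ r`, enlarging `b` only helps, so checking `b = t + q` suffices. -/
lemma pow_le_mul_pow_sub {R r e : ℝ} {t q b : ℕ} (hR : 0 ≤ R) (hRr : R ≤ r) (hb : t + q ≤ b)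
    (he : R ^ t * R ^ q ≤ e * r ^ q) : R ^ b ≤ e * r ^ (b - t) := by
  obtain ⟨m, rfl⟩ := Nat.exists_eq_add_of_le hb
  have h1 : t + q + m - t = q + m := by omega
  rw [h1, pow_add, pow_add, pow_add, ← mul_assoc]
  have he' : 0 ≤ e * r ^ q := le_trans (by positivity) he
  exact mul_le_mul he (pow_le_pow_left₀ hR hRr m) (by positivity) he'

/-- The size bound for the second approximation. -/
lemma mul_div_pow_le {κ ρ ℓ : ℝ} {t : ℕ} (ht : 2 ≤ t) (hκ0 : 0 ≤ κ) (hρ : 0 < ρ)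
    (hκ : κ ≤ 2 * ((t + 1) * ℓ)) (hκρ : κ / ρ ≤ 1 / 2 ^ 17) (hℓ : ℓ ^ 2 ≤ 9 * ρ) :
    κ * (κ / ρ) ^ t ≤ 2 ^ 14 := by
  obtain ⟨m, rfl⟩ : ∃ m, t = m + 1 := ⟨t - 1, by omega⟩
  have hx0 : 0 ≤ κ / ρ := by positivity
  have h2 : ((m : ℝ) + 1 + 1) ≤ 2 ^ (m + 1) := by
    have : m + 1 + 1 ≤ 2 ^ (m + 1) := Nat.lt_two_pow_self
    exact_mod_cast this
  -- One factor `κ / ρ` absorbs `κ`, as `ℓ²` is `O(ρ)`; the other `t - 1` factors, each at most `2 ^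
  -- (-17)`, beat the remaining `4 ^ t`.
  have h1 : κ * (κ / ρ) ≤ 36 * 4 ^ (m + 1) := by
    rw [mul_div_assoc', div_le_iff₀ hρ]
    push_cast at hκ
    calc κ * κ ≤ (2 * ((m + 1 + 1) * ℓ)) * (2 * ((m + 1 + 1) * ℓ)) :=
          mul_le_mul hκ hκ hκ0 (hκ0.trans hκ)
      _ = 4 * ((m : ℝ) + 1 + 1) ^ 2 * ℓ ^ 2 := by ring
      _ ≤ 4 * (2 ^ (m + 1)) ^ 2 * (9 * ρ) := by gcongr
      _ = 36 * 4 ^ (m + 1) * ρ := by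
          rw [← pow_mul, mul_comm (m + 1) 2, pow_mul]; norm_num; ring
  calc κ * (κ / ρ) ^ (m + 1) = κ * (κ / ρ) * (κ / ρ) ^ m := by rw [pow_succ]; ring
    _ ≤ 36 * 4 ^ (m + 1) * (1 / 2 ^ 17) ^ m := by gcongr
    _ = 144 * (4 / 2 ^ 17) ^ m := by
        rw [pow_succ, div_pow, div_pow, one_pow]; ring
    _ ≤ 144 * 1 := by
        gcongr
        exact pow_le_one₀ (by norm_num) (by norm_num)
    _ ≤ 2 ^ 14 := by norm_num

end SpreadFamily

/-! ### Choice of parameters -/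

set_option maxHeartbeats 1000000 in
theorem mainTheorem3 {α : Type*} [DecidableEq α] (s t k : ℕ) (r : ℝ)
    (hs : 2 ≤ s) (ht : 2 ≤ t) (htk : t ≤ k)
    (𝓐 : Finset (Finset α))
    (hunif : (𝓐 : Set (Finset α)).Sized k)
    (hspread : SpreadFamily.IsLocallySpread r t 𝓐)
    (hr₁ : 2 ^ 18 * (s : ℝ) * ((t : ℝ) + 1) * Real.logb 2 r ≤ r)
    (hr₂ : 2 ^ 15 * (s : ℝ) * Real.logb 2 (k : ℝ) ≤ r)
    (𝓕 : Finset (Finset α)) (hsub : 𝓕 ⊆ 𝓐)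
    (hfree : ¬ SpreadFamily.HasSunflowerCoreLE s (t - 1) 𝓕) :
    ∃ 𝓣 : Finset (Finset α),
      𝓣 ⊆ SpreadFamily.layerShadow t 𝓐 ∧
      ¬ SpreadFamily.HasSunflower s 𝓣 ∧
      ((𝓕 \ SpreadFamily.above 𝓕 𝓣).card : ℝ) ≤
        (2 ^ 14 * (s : ℝ) * Real.logb 2 (t : ℝ)) ^ t *
          (2 ^ 19 * (s : ℝ) * ((t : ℝ) + 1) * Real.logb 2 r / r) *
          (SpreadFamily.maxLink t 𝓐 : ℝ) := by
  have hS : (2 : ℝ) ≤ s := by exact_mod_cast hs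
  have hT : (2 : ℝ) ≤ t := by exact_mod_cast ht
  have hk2 : 2 ≤ k := ht.trans htk
  have hlk := SpreadFamily.one_le_logb_two hk2
  have hlt := SpreadFamily.one_le_logb_two ht
  set S : ℝ := (s : ℝ) with hSdef
  set T : ℝ := (t : ℝ) with hTdef
  set lk := Real.logb 2 (k : ℝ) with hlkdef
  set lt := Real.logb 2 T with hltdef
  -- Positivity of `r` comes from the hypothesis on `log k`, as `s ≥ 2` and `log₂ k ≥ 1`.
  have hr16 : (2 : ℝ) ^ 16 ≤ r := by nlinarith
  have hr : 0 < r := lt_of_lt_of_le (by norm_num) hr16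
  set lr := Real.logb 2 r with hlrdef
  have hlr : 16 ≤ lr := by
    rw [hlrdef, Real.le_logb_iff_rpow_le (by norm_num) hr]
    refine le_trans (le_of_eq ?_) hr16
    norm_num
  set ρ := r / S with hρdef
  have hS0 : 0 < S := by linarith
  have hρS : S * ρ = r := by rw [hρdef]; field_simp
  have hρ₁ : 2 ^ 18 * ((T + 1) * lr) ≤ ρ := by
    rw [hρdef, le_div_iff₀ hS0]; linarith
  have hTlr : 48 ≤ (T + 1) * lr := by nlinarith
  have hρ18 : (2 : ℝ) ^ 18 ≤ ρ := by linarith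
  have hρ0 : 0 < ρ := lt_of_lt_of_le (by norm_num) hρ18
  set ℓ := Real.logb 2 ρ with hℓdef
  have hℓ : 18 ≤ ℓ := by
    rw [hℓdef, Real.le_logb_iff_rpow_le (by norm_num) hρ0]
    refine le_trans (le_of_eq ?_) hρ18
    norm_num
  have hρr : ρ ≤ r := by nlinarith
  have hSr : S ≤ r := by nlinarith
  have hℓr : ℓ ≤ lr := Real.logb_le_logb_of_le (by norm_num) hρ0 hρr
  have hlsr : Real.logb 2 S ≤ lr := Real.logb_le_logb_of_le (by norm_num) hS0 hSr
  have hu : 2 ^ 18 * (S * ((T + 1) * lr)) ≤ r := by linarith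
  have hSlr : 3 * (S * lr) ≤ S * ((T + 1) * lr) := by
    have : 3 * lr ≤ (T + 1) * lr := mul_le_mul_of_nonneg_right (by linarith) (by linarith)
    linarith [mul_le_mul_of_nonneg_left this hS0.le]
  have hSlr' : 16 * S ≤ S * lr := by linarith [mul_le_mul_of_nonneg_left hlr hS0.le]
  have hSlk : 2 ^ 15 * (S * lk) ≤ r := by linarith
  have hSlt : S ≤ S * lt := le_mul_of_one_le_right hS0.le hlt
  -- parameters
  set q₁ := ⌈(T + 1) * ℓ⌉₊ with hq₁def
  have hTℓ : 54 ≤ (T + 1) * ℓ := by nlinarith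
  have hTℓr : (T + 1) * ℓ ≤ (T + 1) * lr := mul_le_mul_of_nonneg_left hℓr (by linarith)
  have hq₁le : (T + 1) * ℓ ≤ q₁ := Nat.le_ceil _
  have hq₁lt : (q₁ : ℝ) < (T + 1) * ℓ + 1 := Nat.ceil_lt_add_one (by linarith)
  set κ : ℝ := q₁ + 1 with hκdef
  have hκ0 : 0 < κ := by positivity
  have hκ : κ ≤ 2 * ((T + 1) * ℓ) := by linarith
  have hκr : κ ≤ 2 * ((T + 1) * lr) := by linarith
  have hSκ : S * κ ≤ 2 * (S * ((T + 1) * lr)) := by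
    linarith [mul_le_mul_of_nonneg_left hκr hS0.le]
  have hSq₁ : S * q₁ < S * κ := by rw [hκdef]; linarith
  have htq₁ : t ≤ q₁ := by
    have : (t : ℝ) ≤ q₁ := by
      have : T * 1 ≤ (T + 1) * ℓ :=
        mul_le_mul (by linarith) (by linarith) (by norm_num) (by linarith)
      linarith
    exact_mod_cast this
  set L₁ := Nat.log 2 k + 1 with hL₁
  set a₁ := Nat.log 2 s + 1 with ha₁
  set L₃ := Nat.log 2 (t ^ 2 + t) + 1 with hL₃
  have hL₁le : (L₁ : ℝ) ≤ lk + 1 := by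
    have := Real.natLog_le_logb k 2
    push_cast at this
    rw [hL₁]; push_cast; linarith
  have ha₁le : (a₁ : ℝ) ≤ lr + 1 := by
    have := Real.natLog_le_logb s 2
    push_cast at this
    rw [ha₁]; push_cast; linarith
  have hL₃le : (L₃ : ℝ) ≤ 3 * lt + 1 := by
    have h1 := Real.natLog_le_logb (t ^ 2 + t) 2
    push_cast at h1
    have h2 : Real.logb 2 ((t : ℝ) ^ 2 + t) ≤ Real.logb 2 (T ^ 3) :=
      Real.logb_le_logb_of_le (by norm_num) (by positivity) (by rw [← hTdef]; nlinarith)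
    rw [Real.logb_pow] at h2
    push_cast at h2
    rw [hL₃]; push_cast; linarith
  set P : ℝ := (2 ^ 14 * S * lt) ^ t with hP
  -- A quarter of the factor `2 ^ 19 ⋯ / r` in the claim: the three remainders receive `P * G`, `P *
  -- G` and `P * (2 * G)`.
  set G : ℝ := 2 ^ 17 * S * (T + 1) * lr / r with hG
  have hG0 : 0 < G := by
    have : 0 < lr := by linarith
    positivity
  have hGr : 2 * G * r = 2 ^ 18 * S * (T + 1) * lr := by rw [hG]; field_simp
  have hSG : S / r ≤ G := div_le_div_of_nonneg_right (by linarith) hr.le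
  have hκG : S * κ / r ≤ G := div_le_div_of_nonneg_right (by linarith) hr.le
  have hSP : S ^ t * (2 ^ 14) ^ t ≤ P := by
    rw [hP, ← mul_pow]
    exact pow_le_pow_left₀ (by positivity) (by linarith) t
  have hSP' : S ^ t ≤ P := by
    refine le_trans ?_ hSP
    exact le_mul_of_one_le_right (by positivity) (one_le_pow₀ (by norm_num))
  have hP0 : 0 < P := by positivity
  have hsize : ∀ F ∈ 𝓐, F.card = k := fun F hF => hunif hF
  have hdiv : κ / ρ = S * κ / r := by rw [← hρS]; field_simp
  have hκρ : κ / ρ ≤ 1 / 2 ^ 17 := by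
    rw [div_le_div_iff₀ hρ0 (by norm_num)]; linarith
  have hR₂r : S * κ ≤ r := by linarith
  have hR₃r : 2 ^ 14 * S * lt ≤ 2 ^ 18 * S * (T + 1) * lr := by
    have h1 : lt ≤ T := by
      rw [hltdef, Real.logb_le_iff_le_rpow (by norm_num) (by linarith), hTdef, Real.rpow_natCast]
      exact_mod_cast Nat.lt_two_pow_self.le
    have h2 : lt ≤ (T + 1) * lr := by
      have : T * 1 ≤ (T + 1) * lr :=
        mul_le_mul (by linarith) (by linarith) (by norm_num) (by linarith)
      linarith
    linarith [mul_le_mul_of_nonneg_left h2 hS0.le]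
  obtain ⟨𝓣, h𝓣, hfree𝓣, hcard⟩ := SpreadFamily.exists_layerShadow_cover
    (s := s) (t := t) (k := k) (r := r) (R₁ := r / 2) (R₂ := S * κ) (R₃ := 2 ^ 14 * S * lt)
    (θ := 2 * G) (e₁ := P * G) (e₂ := P * G) (e₃ := P * (2 * G))
    (q₁ := q₁) (q₂ := t ^ 2 + t) (L₁ := L₁) (M₁ := 2 * (L₁ + a₁)) (L₃ := L₃)
    (M₃ := 2 * (L₃ + 1)) hs hr (by positivity)
    htq₁ (by nlinarith) (by positivity) (by omega)
    (by linarith)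
    (by
      push_cast
      linarith [mul_le_mul_of_nonneg_left hL₁le hS0.le, mul_le_mul_of_nonneg_left ha₁le hS0.le])
    (by
      have h1 : (s : ℝ) < 2 ^ a₁ := by exact_mod_cast Nat.lt_pow_succ_log_self (by norm_num) s
      calc (s : ℝ) * (2 ^ L₁ * (5 / 8) ^ (2 * (L₁ + a₁))) ≤ s * (1 / 2) ^ a₁ := by
            gcongr
            exact SpreadFamily.two_pow_mul_pow_le L₁ a₁
        _ < 2 ^ a₁ * (1 / 2) ^ a₁ := by gcongr
        _ = 1 := by rw [← mul_pow]; norm_num)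
    (Nat.lt_pow_succ_log_self (by norm_num) k)
    hSq₁ (by rw [hGr]; linarith)
    (by positivity) (by omega)
    (by push_cast; linarith [mul_le_mul_of_nonneg_left hL₃le hS0.le])
    (by simpa using SpreadFamily.two_pow_mul_pow_le L₃ 1)
    (Nat.lt_pow_succ_log_self (by norm_num) _)
    (by
      intro b hb
      have htb : t ≤ b := htq₁.trans hb.le
      obtain ⟨m, rfl⟩ := Nat.exists_eq_add_of_le htb
      rw [Nat.add_sub_cancel_left, div_pow, pow_add r]
      -- The reason for `q₁ ≥ (t + 1) log₂ ρ`: the remainder factor `r ^ t / 2 ^ b` becomes at most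
      -- `S ^ t · (S / r)`.
      have h2b : ρ ^ (t + 1) ≤ 2 ^ (t + m) := by
        have h1 : ρ = 2 ^ ℓ := (Real.rpow_logb (by norm_num) (by norm_num) hρ0).symm
        rw [← Real.rpow_natCast, ← Real.rpow_natCast, h1, ← Real.rpow_mul (by norm_num)]
        refine Real.rpow_le_rpow_of_exponent_le (by norm_num) ?_
        have h3 : (q₁ : ℝ) ≤ ((t + m : ℕ) : ℝ) := by exact_mod_cast hb.le
        push_cast at h3 ⊢
        linarith
      have h4 : r ^ t / 2 ^ (t + m) ≤ P * G := by
        calc r ^ t / 2 ^ (t + m) ≤ r ^ t / ρ ^ (t + 1) := by gcongr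
          _ = S ^ t * (S / r) := by
              rw [hρdef, div_pow, pow_succ, pow_succ]; field_simp
          _ ≤ P * G := by gcongr
      calc r ^ t * r ^ m / 2 ^ (t + m) = r ^ t / 2 ^ (t + m) * r ^ m := by ring
        _ ≤ _ := by gcongr)
    (by
      intro b hb
      -- `b > t² + t` supplies `t² + 1` factors `R₂ / r = κ / ρ`: `t` of them for each of the `t`
      -- copies of `κ`, and one left over for `G`.
      refine SpreadFamily.pow_le_mul_pow_sub (q := t * t + 1) (by positivity) hR₂r
        (by nlinarith) ?_
      rw [← div_le_iff₀ (by positivity), mul_div_assoc, ← div_pow, ← hdiv]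
      have h1 := SpreadFamily.mul_div_pow_le ht hκ0.le hρ0 hκ hκρ
        (SpreadFamily.logb_two_sq_le (x := ρ) (by linarith))
      calc (S * κ) ^ t * (κ / ρ) ^ (t * t + 1)
          = S ^ t * (κ * (κ / ρ) ^ t) ^ t * (κ / ρ) := by
            rw [pow_succ, pow_mul, mul_pow, mul_pow]; ring
        _ ≤ S ^ t * (2 ^ 14) ^ t * G := by
            rw [hdiv] at h1 ⊢
            gcongr
        _ ≤ P * G := by gcongr)
    (by
      intro b hb
      refine SpreadFamily.pow_le_mul_pow_sub (q := 1) (by positivity) (hR₃r.trans hr₁) hb ?_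
      rw [pow_one, pow_one, mul_assoc P, hGr]
      exact mul_le_mul_of_nonneg_left hR₃r hP0.le)
    le_rfl hsize hspread hsub
    (SpreadFamily.noSmallCore_of_not_hasSunflowerCoreLE hs htk (fun F hF => hsize F (hsub hF)) hfree)
  refine ⟨𝓣, h𝓣, SpreadFamily.not_hasSunflower_of_noSmallCore hs (fun B hB => ?_) hfree𝓣, ?_⟩
  · obtain ⟨F, -, hBF⟩ := Finset.mem_biUnion.1 (h𝓣 hB)
    exact (Finset.mem_powersetCard.1 hBF).2
  · refine hcard.trans (le_of_eq ?_)
    rw [hG]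
    ring
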